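/- Let $(a)_n=a(a+1)\cdots(a+n-1)$. Consider the following five families of polynomials $P_n(\eta;\boldsymbol\lambda)$ with real parameters $\boldsymbol\lambda$, parameter shift $\boldsymbol\delta$, polynomial $c_2(\eta)$, and constants $c_{\mathcal F}$, $f_n(\boldsymbol\lambda)$: * Hermite (no parameter): $P_n=H_n(\eta)=n!\sum_{k=0}^{\lfloor n/2\rfloor}\frac{(-1)^k(2\eta)^{n-2k}}{k!\,(n-2k)!}$, $c_2=\frac14$, $c_{\mathcal F}=1$, $f_n=2n$; * Laguerre ($\boldsymbol\lambda=g$, $\boldsymbol\delta=1$): $P_n=L_n^{(g-1/2)}(\eta)$, $c_2=\eta$, $c_{\mathcal F}=2$, $f_n=-2$; * Jacobi ($\boldsymbol\lambda=(g,h)$, $\boldsymbol\delta=(1,1)$): $P_n=P_n^{(g-1/2,h-1/2)}(\eta)$, $c_2=1-\eta^2$, $c_{\mathcal F}=-4$, $f_n=-2(n+g+h)$; * Bessel ($\boldsymbol\lambda=h$, $\boldsymbol\delta=-1$): $P_n=y_n(\eta;-2h-1)={}_2F_0(-n,n-2h;-;-\frac{\eta}{2})$, $c_2=\frac14\eta^2$,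 $c_{\mathcal F}=1$, $f_n=-\frac12n(2h-n)$; * pseudo Jacobi ($\boldsymbol\lambda=(h,\mu)$, $\boldsymbol\delta=(-1,0)$): $P_n=\frac{(-2i)^n(-h+\frac12-i\mu)_n}{(n-2h)_n}\,{}_2F_1\bigl(-n,n-2h;-h+\frac12-i\mu;\frac{1-i\eta}{2}\bigr)$, $c_2=\frac14(1+\eta^2)$, $c_{\mathcal F}=1$, $f_n=n$; $P_n$ is defined when $(n-2h)_n\neq0$. (Laguerre, Jacobi and pseudo Jacobi polynomials are understood as polynomials in the parameters after cancelling $(a)_n/(a)_k=(a+k)_{n-k}$ in the hypergeometric sum, $a$ being the lower parameter.) Let $\Phi(\eta)=\frac{4}{c_{\mathcal F}^2}c_2(\eta)$, a polynomial of degree $m$ ($m=0$ for Hermite, $1$ for Laguerre, $2$ otherwise) with leading coefficient $c^\Phi$ and zeros $\eta_1,\dots,\eta_m$, and let $c_n(\boldsymbol\lambda)$ be the coefficient of $\eta^n$ in $P_n(\eta;\boldsymbol\lambda)$. Put $$\Delta_n^{(\ell_1,\dots,\ell_m)}=\det\bigl(P_{n+\ell_k}(\eta_j;\boldsymbol\lambda)\bigr)_{1\le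 j,k\le m},\qquad D_n^{(\ell_1,\dots,\ell_m)}=\det\Bigl(\frac{P_{n+\ell_k}(\eta_j;\boldsymbol\lambda)}{P_n(\eta_j;\boldsymbol\lambda)}\Bigr)_{1\le j,k\le m},$$ where for the double zero $\eta_1=\eta_2=0$ in the Bessel case the values $P_l(\eta_2)$ in the second row are replaced by $P_l'(0)$, and define $$\alpha_{n,k}=(-1)^{m-k}\frac{\Delta_n^{(0,\dots,k-1,k+1,\dots,m)}}{\Delta_n^{(0,1,\dots,m-1)}},\quad \beta_n(\boldsymbol\lambda)=c^\Phi\frac{c_n(\boldsymbol\lambda+\boldsymbol\delta)}{c_{n+m}(\boldsymbol\lambda)},\quad \beta^{\mathcal F}_n(\boldsymbol\lambda)=f_{n+1}(\boldsymbol\lambda)\beta_n(\boldsymbol\lambda).$$ Then for each of the families, all real $\boldsymbol\lambda$ and all $n\in\mathbb Z_{\ge0}$: 1. If the denominators $\Delta_n^{(0,\dots,m-1)}$ and $c_{n+m}(\boldsymbol\lambda)$ are nonzero (and, for pseudo Jacobi, $P_n,P_{n+1},P_{n+2}$ are defined), then, as polynomials in $\eta$, $$\frac{4}{c_{\mathcal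 F}}\,c_2(\eta)\,\frac{d}{d\eta}P_{n+1}(\eta;\boldsymbol\lambda)=\beta^{\mathcal F}_n(\boldsymbol\lambda)\sum_{k=0}^m\alpha_{n,k}(\boldsymbol\lambda)\,P_{n+k}(\eta;\boldsymbol\lambda).$$ 2. Whenever all the entries $P_n(\eta_j;\boldsymbol\lambda)$ (with $P_n'(0)$ for the second row in the Bessel case) are nonzero, $\alpha_{n,k}=(-1)^{m-k}D_n^{(0,\dots,k-1,k+1,\dots,m)}/D_n^{(0,1,\dots,m-1)}$, with the convention $x/0=0$ on both sides. 3. Explicitly, $\alpha_{n,m}=1$ and * Hermite: $\beta_n=1$, $\beta^{\mathcal F}_n=2(n+1)$; * Laguerre: $\alpha_{n,0}=-\frac{n+g+\frac12}{n+1}$, $\beta_n=-(n+1)$, $\beta^{\mathcal F}_n=2(n+1)$; * Jacobi: $\alpha_{n,1}=-\frac{(g-h)(2n+g+h+2)}{(n+2)(2n+g+h+1)}$, $\alpha_{n,0}=-\frac{(n+g+\frac12)(n+h+\frac12)(2n+g+h+3)}{(n+1)_2(2n+g+h+1)}$, $\beta_n=-\frac{(n+1)_2}{(2n+g+h+2)_2}$,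 $\beta^{\mathcal F}_n=\frac{2(n+1)_2(n+g+h+1)}{(2n+g+h+2)_2}$; * Bessel: $\alpha_{n,1}=-\frac{4(n-h+1)}{2n-2h+1}$, $\alpha_{n,0}=\frac{2n-2h+3}{2n-2h+1}$, $\beta_n=\frac{4}{(2n-2h+2)_2}$, $\beta^{\mathcal F}_n=\frac{2(n+1)(n-2h+1)}{(2n-2h+2)_2}$; * pseudo Jacobi: $\alpha_{n,1}=-\frac{4\mu(2h-n-1)}{(2h-2n-1)(2h-2n-3)}$, $\alpha_{n,0}=\frac{(2h-n-1)_2\left((2h-2n-1)^2+4\mu^2\right)}{4(h-n-1)_2(2h-2n-1)^2}$, $\beta_n=1$, $\beta^{\mathcal F}_n=n+1$. These equalities hold whenever the assumptions of 1 hold and the explicit denominators are nonzero. The relation in 1 with the explicit coefficients holds whenever the explicit denominators are nonzero (and, for pseudo Jacobi, $P_n,P_{n+1},P_{n+2}$ are defined). Thus for Jacobi, $-(1-\eta^2)P_{n+1}'$ is expressed through $P_n,P_{n+1},P_{n+2}$. 4. All these assumptions (those of 1 and those of 3) are satisfied in the physical range: always for Hermite; for $g>\frac12$ (Laguerre); for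 $g,h>\frac12$ (Jacobi); for $h>n+2$ (Bessel); for $h>n+2$, $\mu>0$ (pseudo Jacobi). -/

import Mathlib

open Polynomial

noncomputable section

/-- The Pochhammer symbol `(a)_n = a (a + 1) ⋯ (a + n - 1)`. -/
def poch (a : ℂ) (n : ℕ) : ℂ := (ascPochhammer ℂ n).eval a

/-- The five families of ordinary quantum mechanics, each together with its (real) parameters `λ`:
Hermite, Laguerre (`λ = g`), Jacobi (`λ = (g, h)`), Bessel (`λ = h`), pseudo Jacobi
(`λ = (h, μ)`). -/
inductive OQM : Type
  | He : OQM
  | L (g : ℝ) : OQM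
  | J (g h : ℝ) : OQM
  | B (h : ℝ) : OQM
  | pJ (h μ : ℝ) : OQM

namespace OQM

/-- The parameter shift `λ ↦ λ + δ`, with `δ = 1` (L), `(1, 1)` (J), `-1` (B), `(-1, 0)` (pJ). -/
def shift : OQM → OQM
  | He => He
  | L g => L (g + 1)
  | J g h => J (g + 1) (h + 1)
  | B h => B (h - 1)
  | pJ h μ => pJ (h - 1) μ

/-- The polynomials `P_n(η; λ)` in the variable `η`:
* He: the (physicists') Hermite polynomial `H_n(η)`;
* L: the Laguerre polynomial `L_n^{(g-1/2)}(η) = (g+1/2)_n / n! · ₁F₁(-n; g+1/2; η)`;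
* J: the Jacobi polynomial
  `P_n^{(g-1/2,h-1/2)}(η) = (g+1/2)_n / n! · ₂F₁(-n, n+g+h; g+1/2; (1-η)/2)`;
* B: the Bessel polynomial `y_n(η; -2h-1) = ₂F₀(-n, n-2h; ; -η/2)`;
* pJ: the monic pseudo Jacobi polynomial
  `(-2i)^n (c)_n / (n-2h)_n · ₂F₁(-n, n-2h; c; (1-iη)/2)`, `c = -h+1/2-iμ`.

A prefactor `(a)_n` and a denominator `(a)_k` are combined into `(a)_n / (a)_k = (a+k)_{n-k}`, so
that the formula is valid for all values of `a`. The pseudo Jacobi polynomial needs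
`(n-2h)_n ≠ 0`, see `PDefined`. -/
def P : OQM → ℕ → ℂ[X]
  | He, n => ∑ k ∈ Finset.range (n / 2 + 1),
      C ((n.factorial : ℂ) * (-1) ^ k / ((k.factorial : ℂ) * ((n - 2 * k).factorial : ℂ)))
        * (C 2 * X) ^ (n - 2 * k)
  | L g, n => ∑ k ∈ Finset.range (n + 1),
      C (poch (g + 1 / 2 + k) (n - k) * poch (-n) k / ((n.factorial : ℂ) * (k.factorial : ℂ)))
        * X ^ k
  | J g h, n => ∑ k ∈ Finset.range (n + 1),
      C (poch (g + 1 / 2 + k) (n - k) * (poch (-n) k * poch (n + g + h) k)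
          / ((n.factorial : ℂ) * (k.factorial : ℂ)))
        * (C (1 / 2) * (1 - X)) ^ k
  | B h, n => ∑ k ∈ Finset.range (n + 1),
      C (poch (-n) k * poch (n - 2 * h) k / (k.factorial : ℂ)) * (C (-1 / 2) * X) ^ k
  | pJ h μ, n => ∑ k ∈ Finset.range (n + 1),
      C ((-2 * Complex.I) ^ n / poch (n - 2 * h) n
          * (poch (-h + 1 / 2 - Complex.I * μ + k) (n - k)
            * (poch (-n) k * poch (n - 2 * h) k) / (k.factorial : ℂ)))
        * (C (1 / 2) * (1 - C Complex.I * X)) ^ k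

/-- The condition on the parameters for `P_n(η; λ)` to be defined. -/
def PDefined : OQM → ℕ → Prop
  | He, _ => True
  | L _, _ => True
  | J _ _, _ => True
  | B _, _ => True
  | pJ h _, n => poch (n - 2 * h) n ≠ 0

/-- `c_n(λ)`: the coefficient of `η ^ n` in `P_n(η; λ)`. -/
def c (S : OQM) (n : ℕ) : ℂ := (S.P n).coeff n

/-- The polynomial `c_2(η)`, where `4 c_2(η) = (dη/dx)²` for the sinusoidal coordinates
`η = x, x², cos 2x, eˣ, sinh x`. -/
def c2 : OQM → ℂ[X]
  | He => C (1 / 4)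
  | L _ => X
  | J _ _ => 1 - X ^ 2
  | B _ => C (1 / 4) * X ^ 2
  | pJ _ _ => C (1 / 4) * (1 + X ^ 2)

/-- The constant `c_F` of the forward shift operator `F = c_F d/dη`. -/
def cF : OQM → ℂ
  | He => 1
  | L _ => 2
  | J _ _ => -4
  | B _ => 1
  | pJ _ _ => 1

/-- The constants `f_n(λ)` of the forward shift relation
`c_F dP_n/dη(η; λ) = f_n(λ) P_{n-1}(η; λ + δ)`, `n ≥ 1`. -/
def f : OQM → ℕ → ℂ
  | He, n => 2 * n
  | L _, _ => -2
  | J g h, n => -2 * (n + g + h)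
  | B h, n => -(1 / 2) * n * (2 * h - n)
  | pJ _ _, n => n

/-- `Φ(η) = (4 / c_F²) c_2(η)`. -/
def Phi (S : OQM) : ℂ[X] := C (4 / S.cF ^ 2) * S.c2

/-- `c^Φ`, the leading coefficient of `Φ`. -/
def cPhi (S : OQM) : ℂ := S.Phi.leadingCoeff

/-- The degree of `Φ`, see `Phi_natDegree`. -/
def m : OQM → ℕ
  | He => 0
  | L _ => 1
  | J _ _ => 2
  | B _ => 2
  | pJ _ _ => 2

/-- The zeros `η_1, …, η_m` of `Φ`. The second component is the order of the derivative which is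
evaluated at the zero: it is `0` for a simple zero; a double zero is listed twice, with the orders
`0` and `1`. -/
def node : (S : OQM) → Fin S.m → ℂ × ℕ
  | He => ![]
  | L _ => ![(0, 0)]
  | J _ _ => ![(1, 0), (-1, 0)]
  | B _ => ![(0, 0), (0, 1)]
  | pJ _ _ => ![(Complex.I, 0), (-Complex.I, 0)]

theorem Phi_eq_prod (S : OQM) : S.Phi = C S.cPhi * ∏ j, (X - C (S.node j).1) := by
  have key : ∀ a : ℂ, S.Phi = C a * ∏ j, (X - C (S.node j).1) →
      S.Phi = C S.cPhi * ∏ j, (X - C (S.node j).1) := by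
    intro a ha
    have hm : (∏ j, (X - C (S.node j).1)).Monic := monic_prod_X_sub_C _ _
    have : S.cPhi = a := by
      rw [cPhi, ha, leadingCoeff_mul, hm.leadingCoeff, leadingCoeff_C, mul_one]
    rw [this, ← ha]
  cases S with
  | He =>
    refine key 1 ?_
    have h : ∏ j, (X - C (He.node j).1) = (1 : ℂ[X]) := Fin.prod_univ_zero _
    rw [h]
    simp [Phi, c2, cF, ← C_mul]
  | L g =>
    refine key 1 ?_
    have h : ∏ j, (X - C ((L g).node j).1) = (X - C 0 : ℂ[X]) := Fin.prod_univ_one _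
    rw [h]
    norm_num [Phi, c2, cF]
  | J g h =>
    refine key (-(1 / 4)) ?_
    have h : ∏ j, (X - C ((J g h).node j).1) = ((X - C 1) * (X - C (-1)) : ℂ[X]) :=
      Fin.prod_univ_two _
    rw [h]
    norm_num [Phi, c2, cF, C_neg]
    ring
  | B h =>
    refine key 1 ?_
    have h : ∏ j, (X - C ((B h).node j).1) = ((X - C 0) * (X - C 0) : ℂ[X]) :=
      Fin.prod_univ_two _
    rw [h, Phi, c2, cF, ← mul_assoc, ← C_mul]
    norm_num [sq]
  | pJ h μ =>
    refine key 1 ?_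
    have h : ∏ j, (X - C ((pJ h μ).node j).1)
        = ((X - C Complex.I) * (X - C (-Complex.I)) : ℂ[X]) := Fin.prod_univ_two _
    have hI : (C Complex.I : ℂ[X]) * C Complex.I = -1 := by rw [← C_mul]; simp
    rw [h, Phi, c2, cF, ← mul_assoc, ← C_mul, C_neg]
    norm_num
    linear_combination hI

theorem cPhi_ne_zero (S : OQM) : S.cPhi ≠ 0 := by
  rw [cPhi, Ne, leadingCoeff_eq_zero, Phi]
  have h1 : (C (4 / S.cF ^ 2) : ℂ[X]) ≠ 0 := by
    rw [Ne, C_eq_zero]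
    cases S <;> norm_num [cF]
  refine mul_ne_zero h1 fun h => ?_
  have h2 := congrArg (fun p => (p.eval 2)) h
  cases S <;> norm_num [c2] at h2

theorem Phi_natDegree (S : OQM) : S.Phi.natDegree = S.m := by
  rw [Phi_eq_prod, natDegree_C_mul S.cPhi_ne_zero, natDegree_prod_of_monic _ _
    fun i _ => monic_X_sub_C _]
  simp

/-- `P_l(η_j; λ)`; for the second copy of a double zero `η_j`, the derivative `P_l'(η_j; λ)`. -/
def value (S : OQM) (l : ℕ) (j : Fin S.m) : ℂ :=
  (derivative^[(S.node j).2] (S.P l)).eval (S.node j).1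

/-- `det (P_{n + ℓ_k}(η_j))_{1 ≤ j, k ≤ m}`. -/
def det (S : OQM) (n : ℕ) (l : Fin S.m → ℕ) : ℂ :=
  Matrix.det (Matrix.of fun j k => S.value (n + l k) j)

/-- The normalized determinant
`D_n^{(ℓ_1, …, ℓ_m)} = det (P_{n + ℓ_k}(η_j) / P_n(η_j))_{1 ≤ j, k ≤ m}`. -/
def D (S : OQM) (n : ℕ) (l : Fin S.m → ℕ) : ℂ :=
  Matrix.det (Matrix.of fun j k => S.value (n + l k) j / S.value n j)

/-- The indices `(0, 1, …, m - 1)`. -/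
def initialIdx (S : OQM) : Fin S.m → ℕ := fun i => i

/-- The indices `(0, 1, …, m)` with `k` removed. -/
def removeIdx (S : OQM) (k : Fin (S.m + 1)) : Fin S.m → ℕ := fun i => k.succAbove i

/-- `α_{n,k}(λ)` as a quotient of the unnormalized determinants. The factor `∏_j P_n(η_j)` that
distinguishes them from the determinants `D_n` cancels in the quotient. -/
def alpha (S : OQM) (n : ℕ) (k : Fin (S.m + 1)) : ℂ :=
  (-1) ^ (S.m - (k : ℕ)) * (S.det n (S.removeIdx k) / S.det n S.initialIdx)

/-- `β_n(λ) = c^Φ c_n(λ + δ) / c_{n+m}(λ)`. -/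
def beta (S : OQM) (n : ℕ) : ℂ := S.cPhi * (S.shift.c n / S.c (n + S.m))

/-- `β^F_n(λ) = f_{n+1}(λ) β_n(λ)`. -/
def betaF (S : OQM) (n : ℕ) : ℂ := S.f (n + 1) * S.beta n

/-- The polynomials `P_n`, `P_{n+1}`, …, `P_{n+max(m,1)}` are defined, and the denominators in
`α_{n,k}` and `β_n` do not vanish. -/
def Regular (S : OQM) (n : ℕ) : Prop :=
  (∀ k ≤ max S.m 1, S.PDefined (n + k)) ∧ S.det n S.initialIdx ≠ 0 ∧ S.c (n + S.m) ≠ 0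

/-- The explicit expressions for `α_{n,k}(λ)`, `0 ≤ k ≤ m`. -/
def alphaExplicit : OQM → ℕ → ℕ → ℂ
  | He, _, _ => 1
  | L g, n, 0 => -((n + g + 1 / 2) / (n + 1))
  | L _, _, _ => 1
  | J g h, n, 0 => -((n + g + 1 / 2) * (n + h + 1 / 2) * (2 * n + g + h + 3)
      / (poch (n + 1) 2 * (2 * n + g + h + 1)))
  | J g h, n, 1 => -((g - h) * (2 * n + g + h + 2) / ((n + 2) * (2 * n + g + h + 1)))
  | J _ _, _, _ => 1
  | B h, n, 0 => (2 * n - 2 * h + 3) / (2 * n - 2 * h + 1)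
  | B h, n, 1 => -(4 * (n - h + 1) / (2 * n - 2 * h + 1))
  | B _, _, _ => 1
  | pJ h μ, n, 0 => poch (2 * h - n - 1) 2 * ((2 * h - 2 * n - 1) ^ 2 + 4 * μ ^ 2)
      / (4 * poch (h - n - 1) 2 * (2 * h - 2 * n - 1) ^ 2)
  | pJ h μ, n, 1 => -(4 * μ * (2 * h - n - 1) / ((2 * h - 2 * n - 1) * (2 * h - 2 * n - 3)))
  | pJ _ _, _, _ => 1

/-- The explicit expressions for `β_n(λ)`. -/
def betaExplicit : OQM → ℕ → ℂ
  | He, _ => 1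
  | L _, n => -(n + 1)
  | J g h, n => -(poch (n + 1) 2 / poch (2 * n + g + h + 2) 2)
  | B h, n => 4 / poch (2 * n - 2 * h + 2) 2
  | pJ _ _, _ => 1

/-- The explicit expressions for `β^F_n(λ)`. -/
def betaFExplicit : OQM → ℕ → ℂ
  | He, n => 2 * (n + 1)
  | L _, n => 2 * (n + 1)
  | J g h, n => 2 * poch (n + 1) 2 * (n + g + h + 1) / poch (2 * n + g + h + 2) 2
  | B h, n => 2 * (n + 1) * (n - 2 * h + 1) / poch (2 * n - 2 * h + 2) 2
  | pJ _ _, n => n + 1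

/-- The polynomials `P_n`, `P_{n+1}`, `P_{n+2}` are defined, and the denominators in the explicit
expressions do not vanish. -/
def ExplicitRegular : OQM → ℕ → Prop
  | He, _ => True
  | L _, _ => True
  | J g h, n => 2 * n + g + h + 1 ≠ 0 ∧ 2 * n + g + h + 2 ≠ 0 ∧ 2 * n + g + h + 3 ≠ 0
  | B h, n => 2 * n - 2 * h + 1 ≠ 0 ∧ 2 * n - 2 * h + 2 ≠ 0 ∧ 2 * n - 2 * h + 3 ≠ 0
  | pJ h μ, n => (∀ k ≤ 2, (pJ h μ).PDefined (n + k)) ∧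
      h - n ≠ 0 ∧ h - n - 1 ≠ 0 ∧ 2 * h - 2 * n - 1 ≠ 0 ∧ 2 * h - 2 * n - 3 ≠ 0

/-- The parameters are physical and the eigenfunction with the polynomial factor `P_N` is
normalizable. -/
def Physical : OQM → ℕ → Prop
  | He, _ => True
  | L g, _ => 1 / 2 < g
  | J g h, _ => 1 / 2 < g ∧ 1 / 2 < h
  | B h, N => 0 < h ∧ N < h
  | pJ h μ, N => 0 < h ∧ 0 < μ ∧ N < h

end OQM

end

noncomputable section

/-! The differential relation is first proved with explicit coefficients. Apart from Hermite, where
it is the formula for the derivative, the families come from three hypergeometric sums with complex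
parameters: `laguerrePoly`, `besselPoly` and `jacobiPoly`. For these the relation is compared
coefficient by coefficient. All Pochhammer symbols at `n`, `n+1`, `n+2` are reduced to common ones,
which leaves a polynomial identity. An affine substitution then gives the families. Pseudo Jacobi is
Jacobi with `a = -h+1/2-iμ`, `t = -2h` in the variable `(1-iη)/2`, up to a constant. The outcome is
`relation_reduced`.

At the zeros of `Φ` the left side of the relation vanishes (for Bessel, to second order). So the
`m+1` value vectors of `P_n, …, P_{n+m}` should satisfy a linear relation with last coefficient 1,
and Cramer's rule identifies its coefficients with the determinant quotients `α_{n,k}`. This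
dependence cannot simply be read off from the differential relation, because `β^F_n` may be zero. It
is checked directly on closed forms of the values (`sum_alphaReduced_mul_value`). At one endpoint
the Jacobi value is a constant term, at the other it is Chu–Vandermonde.

The quotient `β_n` follows from the leading coefficients. The factors of the determinant and of
`c_{n+m}` show that the abstract nonvanishing assumptions imply those needed for the relation
(`Regular.relationRegular`). -/

/-! ### Pochhammer symbols and Chu–Vandermonde -/

theorem poch_zero (a : ℂ) : poch a 0 = 1 := by simp [poch]

theorem poch_succ (a : ℂ) (n : ℕ) : poch a (n + 1) = poch a n * (a + n) := by
  simp [poch, ascPochhammer_succ_eval]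

theorem poch_succ_left (a : ℂ) (n : ℕ) : poch a (n + 1) = a * poch (a + 1) n := by
  simp [poch, ascPochhammer_succ_left, eval_comp]

theorem poch_one (a : ℂ) : poch a 1 = a := by simp [poch]

theorem poch_two (a : ℂ) : poch a 2 = a * (a + 1) := by
  rw [poch_succ, poch_one]; simp

theorem poch_ne_zero_iff (a : ℂ) (n : ℕ) : poch a n ≠ 0 ↔ ∀ k < n, a + k ≠ 0 := by
  induction n with
  | zero => simp [poch_zero]
  | succ n ih => rw [poch_succ, mul_ne_zero_iff, ih, Nat.forall_lt_succ_right]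

theorem poch_neg_of_lt {n k : ℕ} (h : n < k) : poch (-n) k = 0 := by
  by_contra hne
  exact (poch_ne_zero_iff _ _).1 hne n h (by simp)

theorem poch_neg_self (n : ℕ) : poch (-n) n = (-1) ^ n * n.factorial := by
  induction n with
  | zero => simp [poch_zero]
  | succ n ih =>
    rw [poch_succ_left]
    have : (-((n + 1 : ℕ) : ℂ) + 1) = -n := by push_cast; ring
    rw [this, ih, Nat.factorial_succ]
    push_cast
    ring

/-- `(-N)_k = (-1)^k k! (N choose k)`. -/
theorem poch_neg_eq_choose (n k : ℕ) :
    poch (-n) k = (-1) ^ k * k.factorial * n.choose k := by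
  induction k with
  | zero => simp [poch_zero]
  | succ k ih =>
    have h := congrArg (Nat.cast : ℕ → ℂ) (Nat.choose_succ_right_eq n k)
    rcases le_or_gt k n with hk | hk
    · push_cast [hk] at h
      rw [poch_succ, ih, Nat.factorial_succ]
      push_cast
      linear_combination (-1) ^ k * (k.factorial : ℂ) * h
    · rw [poch_neg_of_lt (by omega), Nat.choose_eq_zero_of_lt (by omega)]
      simp

/-- The Chu–Vandermonde identity. -/
theorem sum_choose_poch (N : ℕ) (a b : ℂ) :
    ∑ k ∈ Finset.range (N + 1), (-1) ^ k * (N.choose k : ℂ) * (poch (a + k) (N - k) * poch b k)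
      = poch (a - b) N := by
  induction N generalizing a b with
  | zero => simp [poch_zero]
  | succ N ih =>
    -- Pascal's rule splits the sum for `N + 1` in two. In this part the extra last factor `a + N`
    -- does not depend on `k`.
    have h1 : ∑ k ∈ Finset.range (N + 1 + 1),
        (-1) ^ k * (N.choose k : ℂ) * (poch (a + k) (N + 1 - k) * poch b k)
        = (a + N) * poch (a - b) N := by
      rw [Finset.sum_range_succ, Nat.choose_succ_self, ← ih a b, Finset.mul_sum]
      simp only [Nat.cast_zero, mul_zero, zero_mul, add_zero]
      refine Finset.sum_congr rfl fun k hk => ?_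
      have hk' : k ≤ N := Nat.lt_succ_iff.1 (Finset.mem_range.1 hk)
      rw [Nat.succ_sub hk', poch_succ, Nat.cast_sub hk']
      ring
    -- In the other part `a` and `b` both move by 1, which leaves `a - b` unchanged.
    have h2 : ∑ k ∈ Finset.range (N + 1),
        (-1) ^ (k + 1) * (N.choose k : ℂ) * (poch (a + (k + 1 : ℕ)) (N - k) * poch b (k + 1))
        = -b * poch (a - b) N := by
      have := ih (a + 1) (b + 1)
      rw [add_sub_add_right_eq_sub] at this
      rw [← this, Finset.mul_sum]
      refine Finset.sum_congr rfl fun k _ => ?_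
      rw [poch_succ_left, show a + ((k + 1 : ℕ) : ℂ) = a + 1 + k by push_cast; ring]
      ring
    rw [poch_succ, show poch (a - b) N * (a - b + N)
      = (a + N) * poch (a - b) N + -b * poch (a - b) N by ring, ← h1, ← h2,
      Finset.sum_range_succ' _ (N + 1), Finset.sum_range_succ' _ (N + 1), add_right_comm,
      ← Finset.sum_add_distrib]
    congr 1
    · refine Finset.sum_congr rfl fun k _ => ?_
      rw [Nat.choose_succ_succ, Nat.add_sub_add_right]
      push_cast
      ring
    · simp

/-! ### Polynomials given by their coefficients -/

/-- The polynomial `∑_{k ≤ N} q_k X^k`. -/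
def truncPoly (q : ℕ → ℂ) (N : ℕ) : ℂ[X] := ∑ k ∈ Finset.range (N + 1), C (q k) * X ^ k

theorem coeff_truncPoly {q : ℕ → ℂ} {N : ℕ} (hq : ∀ k, N < k → q k = 0) (k : ℕ) :
    (truncPoly q N).coeff k = q k := by
  simp only [truncPoly, finsetSum_coeff, coeff_C_mul, coeff_X_pow, mul_ite, mul_one, mul_zero,
    Finset.sum_ite_eq, Finset.mem_range]
  split_ifs with h
  · rfl
  · exact (hq k (by omega)).symm

theorem truncPoly_comp (q : ℕ → ℂ) (N : ℕ) (p : ℂ[X]) :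
    (truncPoly q N).comp p = ∑ k ∈ Finset.range (N + 1), C (q k) * p ^ k := by
  simp [truncPoly, sum_comp]

theorem eval_truncPoly (q : ℕ → ℂ) (N : ℕ) (x : ℂ) :
    (truncPoly q N).eval x = ∑ k ∈ Finset.range (N + 1), q k * x ^ k := by
  simp [truncPoly, eval_finsetSum]

/-- Powers `p ^ k` with `k < N` have degree below `N`, so only the top term contributes. This gives
the leading coefficients `c_n`. -/
theorem coeff_truncPoly_comp (q : ℕ → ℂ) (N : ℕ) {p : ℂ[X]} (hp : p.natDegree ≤ 1) :
    ((truncPoly q N).comp p).coeff N = q N * p.coeff 1 ^ N := by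
  rw [truncPoly_comp, Finset.sum_range_succ, coeff_add, finsetSum_coeff, Finset.sum_eq_zero,
    zero_add, coeff_C_mul]
  · congr 1
    simpa using coeff_pow_of_natDegree_le (m := N) hp
  · intro k hk
    rw [coeff_C_mul, coeff_eq_zero_of_natDegree_lt, mul_zero]
    calc (p ^ k).natDegree ≤ k * p.natDegree := natDegree_pow_le
      _ ≤ k * 1 := Nat.mul_le_mul_left _ hp
      _ < N := by simpa using hk

/-! ### Coefficient identities for the three hypergeometric sums -/

/-- The coefficients of the Laguerre polynomials `L_N^{(a-1)}`. -/
def laguerreCoeff (a : ℂ) (N k : ℕ) : ℂ :=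
  poch (a + k) (N - k) * poch (-N) k / ((N.factorial : ℂ) * (k.factorial : ℂ))

/-- The coefficients of the Bessel polynomials in powers of `-η/2`. -/
def besselCoeff (t : ℂ) (N k : ℕ) : ℂ := poch (-N) k * poch (N + t) k / (k.factorial : ℂ)

/-- The coefficients of the Jacobi polynomials `P_N^{(a-1,t-a)}` in powers of `(1-η)/2`. -/
def jacobiCoeff (a t : ℂ) (N k : ℕ) : ℂ :=
  poch (a + k) (N - k) * (poch (-N) k * poch (N + t) k) / ((N.factorial : ℂ) * (k.factorial : ℂ))

/-- Up to sign both sides are `(-n-1)_{k+1}`, with either its first or its last factor split off. -/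
theorem poch_neg_succ (n k : ℕ) :
    (n + 1 : ℂ) * poch (-n) k = (n + 1 - k) * poch (-((n + 1 : ℕ) : ℂ)) k := by
  have h1 := poch_succ (-((n + 1 : ℕ) : ℂ)) k
  have h2 := poch_succ_left (-((n + 1 : ℕ) : ℂ)) k
  rw [show -((n + 1 : ℕ) : ℂ) + 1 = -n by push_cast; ring] at h2
  rw [h2] at h1
  push_cast at h1 ⊢
  linear_combination -h1

theorem laguerreCoeff_relation (a : ℂ) (n k : ℕ) :
    (k : ℂ) * laguerreCoeff a (n + 1) k
      = (n + 1) * laguerreCoeff a (n + 1) k - (n + a) * laguerreCoeff a n k := by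
  have hn : (n.factorial : ℂ) ≠ 0 := by exact_mod_cast n.factorial_ne_zero
  have hk : (k.factorial : ℂ) ≠ 0 := by exact_mod_cast k.factorial_ne_zero
  have hn1 : (n + 1 : ℂ) ≠ 0 := by exact_mod_cast n.succ_ne_zero
  have h := poch_neg_succ n k
  unfold laguerreCoeff
  rw [Nat.factorial_succ]
  rcases le_or_gt k n with hkn | hkn
  · rw [Nat.succ_sub hkn, poch_succ, Nat.cast_sub hkn]
    push_cast at h ⊢
    field_simp
    linear_combination poch (a + k) (n - k) * (a + n) * h
  -- Beyond degree `n` the coefficient of `P_n` vanishes, and `h` becomes `(n+1-k)(-n-1)_k = 0`,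
  -- which is the whole claim.
  · rw [poch_neg_of_lt hkn]
    rw [poch_neg_of_lt hkn] at h
    push_cast at h ⊢
    field_simp
    linear_combination poch (a + k) (n + 1 - k) * h

/-- `X² p'` has coefficient `k p_k` at `X^{k+1}`, hence the index shift. All symbols reduce to
`(-n-1)_k` and `(n+1+t)_k`. The factors `n+1` and `n+1+t` on the right allow this without division,
so `t` is unrestricted. -/
theorem besselCoeff_relation (t : ℂ) (n k : ℕ) :
    -((2 * n + t + 1) * (2 * n + t + 2) * (2 * n + t + 3)) * (k * besselCoeff t (n + 1) k)
      = (n + 1) * (n + 1 + t) * ((2 * n + t + 1) * besselCoeff t (n + 2) (k + 1)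
        - 2 * (2 * n + t + 2) * besselCoeff t (n + 1) (k + 1)
        + (2 * n + t + 3) * besselCoeff t n (k + 1)) := by
  have hk : (k.factorial : ℂ) ≠ 0 := by exact_mod_cast k.factorial_ne_zero
  have hk1 : (k + 1 : ℂ) ≠ 0 := by exact_mod_cast k.succ_ne_zero
  have e1 : poch (-((n + 2 : ℕ) : ℂ)) (k + 1) = -(n + 2) * poch (-((n + 1 : ℕ) : ℂ)) k := by
    rw [poch_succ_left]; push_cast; ring_nf
  have e2 : poch (-((n + 1 : ℕ) : ℂ)) (k + 1) = poch (-((n + 1 : ℕ) : ℂ)) k * (k - n - 1) := by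
    rw [poch_succ]; push_cast; ring
  have e3 : (n + 1) * poch (-(n : ℂ)) (k + 1)
      = -((k - n - 1) * (k - n) * poch (-((n + 1 : ℕ) : ℂ)) k) := by
    rw [poch_neg_succ, e2]; push_cast; ring
  have g1 : (n + 1 + t) * poch (((n + 2 : ℕ) : ℂ) + t) (k + 1)
      = poch (((n + 1 : ℕ) : ℂ) + t) k * (n + 1 + t + k) * (n + 2 + t + k) := by
    have := poch_succ_left (((n + 1 : ℕ) : ℂ) + t) (k + 1)
    rw [poch_succ, poch_succ, show ((n + 1 : ℕ) : ℂ) + t + 1 = ((n + 2 : ℕ) : ℂ) + t by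
      push_cast; ring] at this
    push_cast at this ⊢
    linear_combination -this
  have g2 : poch (((n + 1 : ℕ) : ℂ) + t) (k + 1)
      = poch (((n + 1 : ℕ) : ℂ) + t) k * (n + 1 + t + k) := by
    rw [poch_succ]; push_cast; ring
  have g3 : poch ((n : ℂ) + t) (k + 1) = (n + t) * poch (((n + 1 : ℕ) : ℂ) + t) k := by
    rw [poch_succ_left]; push_cast; ring_nf
  unfold besselCoeff
  rw [Nat.factorial_succ, e1, e2, g2, g3]
  generalize poch (-((n + 1 : ℕ) : ℂ)) k = E at *
  generalize poch (((n + 1 : ℕ) : ℂ) + t) k = F at *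
  generalize poch (((n + 2 : ℕ) : ℂ) + t) (k + 1) = G at *
  generalize poch (-(n : ℂ)) (k + 1) = H at *
  push_cast
  field_simp
  linear_combination (n + 1) * (n + 2) * E * (2 * n + t + 1) * g1
    - (n + 1 + t) * (2 * n + t + 3) * (n + t) * F * e3

theorem jacobiCoeff_relation_zero (a t : ℂ) (n : ℕ) :
    (n + 1) * (n + 2) * (2 * n + t + 1) * jacobiCoeff a t (n + 2) 0
      - (n + 1) * (2 * a - t - 1) * (2 * n + t + 2) * jacobiCoeff a t (n + 1) 0
      - (n + a) * (n + (t + 1 - a)) * (2 * n + t + 3) * jacobiCoeff a t n 0 = 0 := by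
  have hn : (n.factorial : ℂ) ≠ 0 := by exact_mod_cast n.factorial_ne_zero
  have hn1 : (n + 1 : ℂ) ≠ 0 := by exact_mod_cast n.succ_ne_zero
  have hn2 : (n + 2 : ℂ) ≠ 0 := by exact_mod_cast (n + 1).succ_ne_zero
  unfold jacobiCoeff
  simp only [Nat.sub_zero, poch_zero, poch_succ, Nat.factorial_succ]
  push_cast
  rw [show (n + 1 + 1 : ℂ) = n + 2 by ring]
  field_simp
  ring

theorem jacobiCoeff_relation_succ (a t : ℂ) (n k : ℕ) :
    (2 * n + t + 1) * (2 * n + t + 2) * (2 * n + t + 3)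
        * ((k + 1) * jacobiCoeff a t (n + 1) (k + 1) - k * jacobiCoeff a t (n + 1) k)
      = (n + t + 1) * ((n + 1) * (n + 2) * (2 * n + t + 1) * jacobiCoeff a t (n + 2) (k + 1)
        - (n + 1) * (2 * a - t - 1) * (2 * n + t + 2) * jacobiCoeff a t (n + 1) (k + 1)
        - (n + a) * (n + (t + 1 - a)) * (2 * n + t + 3) * jacobiCoeff a t n (k + 1)) := by
  have hn : (n.factorial : ℂ) ≠ 0 := by exact_mod_cast n.factorial_ne_zero
  have hn1 : (n + 1 : ℂ) ≠ 0 := by exact_mod_cast n.succ_ne_zero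
  have hn2 : (n + 2 : ℂ) ≠ 0 := by exact_mod_cast (n + 1).succ_ne_zero
  have hk : (k.factorial : ℂ) ≠ 0 := by exact_mod_cast k.factorial_ne_zero
  have hk1 : (k + 1 : ℂ) ≠ 0 := by exact_mod_cast k.succ_ne_zero
  have e1 : poch (-((n + 2 : ℕ) : ℂ)) (k + 1) = -(n + 2) * poch (-((n + 1 : ℕ) : ℂ)) k := by
    rw [poch_succ_left]; push_cast; ring_nf
  have e2 : poch (-((n + 1 : ℕ) : ℂ)) (k + 1) = poch (-((n + 1 : ℕ) : ℂ)) k * (k - n - 1) := by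
    rw [poch_succ]; push_cast; ring
  have e3 : (n + 1) * poch (-(n : ℂ)) (k + 1)
      = -((k - n - 1) * (k - n) * poch (-((n + 1 : ℕ) : ℂ)) k) := by
    rw [poch_neg_succ, e2]; push_cast; ring
  have g1 : (n + 1 + t) * poch (((n + 2 : ℕ) : ℂ) + t) (k + 1)
      = poch (((n + 1 : ℕ) : ℂ) + t) k * (n + 1 + t + k) * (n + 2 + t + k) := by
    have := poch_succ_left (((n + 1 : ℕ) : ℂ) + t) (k + 1)
    rw [poch_succ, poch_succ, show ((n + 1 : ℕ) : ℂ) + t + 1 = ((n + 2 : ℕ) : ℂ) + t by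
      push_cast; ring] at this
    push_cast at this ⊢
    linear_combination -this
  have g2 : poch (((n + 1 : ℕ) : ℂ) + t) (k + 1)
      = poch (((n + 1 : ℕ) : ℂ) + t) k * (n + 1 + t + k) := by
    rw [poch_succ]; push_cast; ring
  have g3 : poch ((n : ℂ) + t) (k + 1) = (n + t) * poch (((n + 1 : ℕ) : ℂ) + t) k := by
    rw [poch_succ_left]; push_cast; ring_nf
  unfold jacobiCoeff
  rw [Nat.factorial_succ (n + 1), Nat.factorial_succ n, Nat.factorial_succ k, e1, e2, g2, g3]
  -- The lengths `n+1-k`, `n-k`, `n-(k+1)` are truncated subtractions, so `k > n+1`, `k = n+1` and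
  -- `k ≤ n` are separated.
  rcases lt_or_ge (n + 1) k with hkn | hkn
  · have e0 : poch (-((n + 1 : ℕ) : ℂ)) k = 0 := poch_neg_of_lt hkn
    rw [e0, poch_neg_of_lt (show n < k + 1 by omega)]
    simp
  generalize poch (-((n + 1 : ℕ) : ℂ)) k = E at *
  generalize poch (((n + 1 : ℕ) : ℂ) + t) k = F at *
  generalize poch (((n + 2 : ℕ) : ℂ) + t) (k + 1) = G at *
  generalize poch (-(n : ℂ)) (k + 1) = H at *
  rw [show n + 2 - (k + 1) = n + 1 - k by omega, show n + 1 - (k + 1) = n - k by omega]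
  obtain rfl | hkn : k = n + 1 ∨ k ≤ n := by omega
  · have e4 : H = 0 := by
      have : (n + 1) * H = 0 := by rw [e3]; push_cast; ring
      exact (mul_eq_zero.1 this).resolve_left hn1
    rw [e4]
    simp only [Nat.sub_self, poch_zero]
    push_cast at g1 ⊢
    rw [show (n + 1 + 1 : ℂ) = n + 2 by ring] at *
    field_simp
    linear_combination (n + 1) * (n + 2) * E * (2 * n + t + 1) * g1
  have f1 : poch (a + k) (n + 1 - k) = (a + k) * poch (a + (k + 1 : ℕ)) (n - k) := by
    rw [Nat.succ_sub hkn, poch_succ_left]; push_cast; ring_nf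
  have f2 : poch (a + (k + 1 : ℕ)) (n + 1 - k) = poch (a + (k + 1 : ℕ)) (n - k) * (a + n + 1) := by
    rw [Nat.succ_sub hkn, poch_succ, Nat.cast_sub hkn]; push_cast; ring
  -- At `k = n` the length `n-(k+1)` truncates to 0, but then `H = (-n)_{n+1}` vanishes and both
  -- sides are zero.
  have f3 : (n + 1) * H * ((n + a) * poch (a + (k + 1 : ℕ)) (n - (k + 1)))
      = (n + 1) * H * poch (a + (k + 1 : ℕ)) (n - k) := by
    obtain rfl | hlt := hkn.eq_or_lt
    · rw [e3]; ring
    · rw [show n - k = n - (k + 1) + 1 by omega, poch_succ, Nat.cast_sub hlt]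
      push_cast; ring
  rw [f1, f2]
  generalize poch (a + (k + 1 : ℕ)) (n - k) = A at *
  generalize poch (a + (k + 1 : ℕ)) (n - (k + 1)) = B at *
  push_cast
  rw [show (n + 1 + 1 : ℂ) = n + 2 by ring]
  field_simp
  linear_combination (n + 1) * (n + 2) * (2 * n + t + 1) * (a + n + 1) * A * E * g1
    + (n + t + 1) * (2 * n + t + 3) * F * (n + t) * (n + t + 1 - a) * (f3 + A * e3)

/-! ### The three base polynomials and their differential relations -/

theorem coeff_X_mul_derivative (p : ℂ[X]) (k : ℕ) :
    (X * derivative p).coeff k = k * p.coeff k := by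
  cases k with
  | zero => simp
  | succ k => rw [coeff_X_mul, coeff_derivative]; push_cast; ring

theorem laguerreCoeff_eq_zero (a : ℂ) {N k : ℕ} (h : N < k) : laguerreCoeff a N k = 0 := by
  simp [laguerreCoeff, poch_neg_of_lt h]

theorem besselCoeff_eq_zero (t : ℂ) {N k : ℕ} (h : N < k) : besselCoeff t N k = 0 := by
  simp [besselCoeff, poch_neg_of_lt h]

theorem jacobiCoeff_eq_zero (a t : ℂ) {N k : ℕ} (h : N < k) : jacobiCoeff a t N k = 0 := by
  simp [jacobiCoeff, poch_neg_of_lt h]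

/-- The Laguerre polynomial `L_N^{(a-1)}`. -/
def laguerrePoly (a : ℂ) (N : ℕ) : ℂ[X] := truncPoly (laguerreCoeff a N) N

/-- The Bessel polynomial `₂F₀(-N, N+t; ; X)`. -/
def besselPoly (t : ℂ) (N : ℕ) : ℂ[X] := truncPoly (besselCoeff t N) N

/-- The Jacobi polynomial `(a)_N / N! · ₂F₁(-N, N+t; a; X)`. -/
def jacobiPoly (a t : ℂ) (N : ℕ) : ℂ[X] := truncPoly (jacobiCoeff a t N) N

theorem coeff_laguerrePoly (a : ℂ) (N k : ℕ) : (laguerrePoly a N).coeff k = laguerreCoeff a N k :=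
  coeff_truncPoly (fun _ h => laguerreCoeff_eq_zero a h) k

theorem coeff_besselPoly (t : ℂ) (N k : ℕ) : (besselPoly t N).coeff k = besselCoeff t N k :=
  coeff_truncPoly (fun _ h => besselCoeff_eq_zero t h) k

theorem coeff_jacobiPoly (a t : ℂ) (N k : ℕ) : (jacobiPoly a t N).coeff k = jacobiCoeff a t N k :=
  coeff_truncPoly (fun _ h => jacobiCoeff_eq_zero a t h) k

theorem laguerrePoly_relation (a : ℂ) (n : ℕ) :
    X * derivative (laguerrePoly a (n + 1))
      = C (n + 1 : ℂ) * laguerrePoly a (n + 1) - C (n + a) * laguerrePoly a n := by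
  ext k
  rw [coeff_X_mul_derivative, coeff_sub, coeff_C_mul, coeff_C_mul, coeff_laguerrePoly,
    coeff_laguerrePoly, laguerreCoeff_relation]

theorem besselPoly_relation (t : ℂ) (n : ℕ) :
    C (-((2 * n + t + 1) * (2 * n + t + 2) * (2 * n + t + 3)))
        * (X ^ 2 * derivative (besselPoly t (n + 1)))
      = C ((n + 1) * (n + 1 + t)) * (C (2 * n + t + 1) * besselPoly t (n + 2)
        - C (2 * (2 * n + t + 2)) * besselPoly t (n + 1)
        + C (2 * n + t + 3) * besselPoly t n) := by
  ext k
  rw [sq, mul_assoc X X]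
  simp only [coeff_sub, coeff_add, coeff_C_mul, coeff_besselPoly]
  cases k with
  | zero => simp [besselCoeff, poch_zero]; ring_nf; simp
  | succ k =>
    rw [coeff_X_mul, coeff_X_mul_derivative, coeff_besselPoly, besselCoeff_relation]

theorem jacobiPoly_relation (a t : ℂ) (n : ℕ) :
    C ((2 * n + t + 1) * (2 * n + t + 2) * (2 * n + t + 3))
        * (X * (1 - X) * derivative (jacobiPoly a t (n + 1)))
      = C (n + t + 1) * (C ((n + 1) * (n + 2) * (2 * n + t + 1)) * jacobiPoly a t (n + 2)
        - C ((n + 1) * (2 * a - t - 1) * (2 * n + t + 2)) * jacobiPoly a t (n + 1)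
        - C ((n + a) * (n + (t + 1 - a)) * (2 * n + t + 3)) * jacobiPoly a t n) := by
  ext k
  rw [show X * (1 - X) * derivative (jacobiPoly a t (n + 1))
    = X * derivative (jacobiPoly a t (n + 1)) - X * (X * derivative (jacobiPoly a t (n + 1))) by
      ring]
  simp only [coeff_sub, coeff_C_mul, coeff_jacobiPoly]
  cases k with
  | zero => rw [jacobiCoeff_relation_zero]; simp
  | succ k =>
    rw [coeff_X_mul (X * _), coeff_X_mul_derivative, coeff_X_mul_derivative, coeff_jacobiPoly,
      coeff_jacobiPoly, ← jacobiCoeff_relation_succ]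
    push_cast
    rfl

/-! ### Endpoint values, leading coefficients and change of variable -/

theorem eval_laguerrePoly_zero (a : ℂ) (N : ℕ) :
    (laguerrePoly a N).eval 0 = poch a N / N.factorial := by
  rw [← coeff_zero_eq_eval_zero, coeff_laguerrePoly, laguerreCoeff]
  simp [poch_zero]

theorem eval_jacobiPoly_zero (a t : ℂ) (N : ℕ) :
    (jacobiPoly a t N).eval 0 = poch a N / N.factorial := by
  rw [← coeff_zero_eq_eval_zero, coeff_jacobiPoly, jacobiCoeff]
  simp [poch_zero]

/-- The factors on the left are those on the right, negated and in reverse order. -/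
theorem poch_reflect (x : ℂ) (N : ℕ) : poch (-x - N) N = (-1) ^ N * poch (x + 1) N := by
  induction N with
  | zero => simp [poch_zero]
  | succ N ih =>
    rw [poch_succ_left, poch_succ (x + 1), show -x - ((N + 1 : ℕ) : ℂ) + 1 = -x - N by
      push_cast; ring, ih]
    push_cast
    ring

/-- Since `(-N)_k / k! = (-1)^k (N choose k)`, this is Chu–Vandermonde with `b = N + t`. Its value
`(a-N-t)_N` is then reflected. -/
theorem eval_jacobiPoly_one (a t : ℂ) (N : ℕ) :
    (jacobiPoly a t N).eval 1 = (-1) ^ N * poch (t + 1 - a) N / N.factorial := by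
  have hN : (N.factorial : ℂ) ≠ 0 := by exact_mod_cast N.factorial_ne_zero
  have h := sum_choose_poch N a (N + t)
  rw [show a - (N + t) = -(t - a) - N by ring, poch_reflect,
    show t - a + 1 = t + 1 - a by ring] at h
  rw [jacobiPoly, eval_truncPoly, ← h, Finset.sum_div]
  refine Finset.sum_congr rfl fun k _ => ?_
  have hk : (k.factorial : ℂ) ≠ 0 := by exact_mod_cast k.factorial_ne_zero
  rw [jacobiCoeff, poch_neg_eq_choose]
  field_simp
  simp

theorem natDegree_half_mul (u : ℂ) : (C (1 / 2) * (1 - C u * X) : ℂ[X]).natDegree ≤ 1 := by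
  compute_degree

theorem coeff_half_mul (u : ℂ) : (C (1 / 2) * (1 - C u * X) : ℂ[X]).coeff 1 = -u / 2 := by
  rw [coeff_C_mul, coeff_sub, coeff_C_mul, coeff_X_one, coeff_one]
  norm_num
  ring

theorem laguerreCoeff_self (a : ℂ) (N : ℕ) : laguerreCoeff a N N = (-1) ^ N / N.factorial := by
  have hN : (N.factorial : ℂ) ≠ 0 := by exact_mod_cast N.factorial_ne_zero
  rw [laguerreCoeff, poch_neg_self, Nat.sub_self, poch_zero]
  field_simp

theorem besselCoeff_self (t : ℂ) (N : ℕ) : besselCoeff t N N = (-1) ^ N * poch (N + t) N := by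
  have hN : (N.factorial : ℂ) ≠ 0 := by exact_mod_cast N.factorial_ne_zero
  rw [besselCoeff, poch_neg_self]
  field_simp

theorem jacobiCoeff_self (a t : ℂ) (N : ℕ) :
    jacobiCoeff a t N N = (-1) ^ N * poch (N + t) N / N.factorial := by
  have hN : (N.factorial : ℂ) ≠ 0 := by exact_mod_cast N.factorial_ne_zero
  rw [jacobiCoeff, poch_neg_self, Nat.sub_self, poch_zero]
  field_simp

/-- The Jacobi relation after the substitution `y = (1 - u η) / 2`. -/
theorem jacobiPoly_comp_relation (a t u : ℂ) (n : ℕ) :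
    C ((2 * n + t + 1) * (2 * n + t + 2) * (2 * n + t + 3))
        * ((1 - (C u * X) ^ 2)
          * derivative ((jacobiPoly a t (n + 1)).comp (C (1 / 2) * (1 - C u * X))))
      = C (-2 * u * (n + t + 1)) * (C ((n + 1) * (n + 2) * (2 * n + t + 1))
          * (jacobiPoly a t (n + 2)).comp (C (1 / 2) * (1 - C u * X))
        - C ((n + 1) * (2 * a - t - 1) * (2 * n + t + 2))
          * (jacobiPoly a t (n + 1)).comp (C (1 / 2) * (1 - C u * X))
        - C ((n + a) * (n + (t + 1 - a)) * (2 * n + t + 3))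
          * (jacobiPoly a t n).comp (C (1 / 2) * (1 - C u * X))) := by
  have h := congrArg (fun p => p.comp (C (1 / 2) * (1 - C u * X))) (jacobiPoly_relation a t n)
  simp only [mul_comp, sub_comp, C_comp, X_comp, one_comp] at h
  have h2 : (C (1 / 2) : ℂ[X]) * 2 = 1 := by
    rw [show (2 : ℂ[X]) = C 2 by rfl, ← C_mul]; norm_num
  have hd : derivative (C (1 / 2) * (1 - C u * X) : ℂ[X]) = C (1 / 2) * (-C u) := by simp
  have h3 : (C (-2 * u * (n + t + 1)) : ℂ[X]) = -2 * C u * C (n + t + 1) := by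
    rw [C_mul, C_mul, C_neg]; rfl
  rw [derivative_comp, hd, h3]
  -- With `y = (1-uη)/2` one has `4y(1-y) = 1-(uη)²` and `dy/dη = -u/2`, hence the factor `-2u`.
  linear_combination -2 * C u * h - C ((2 * n + t + 1) * (2 * n + t + 2) * (2 * n + t + 3)) * C u
    * (derivative (jacobiPoly a t (n + 1))).comp (C (1 / 2) * (1 - C u * X))
    * C (1 / 2) * (1 - C u * X) ^ 2 * h2

/-! ### Linear algebra and auxiliary identities -/

/-- Cramer's rule for the coefficients of a linear relation among `m + 1` vectors of length
`m ≤ 2`. -/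
theorem cramer_of_sum_eq_zero {m : ℕ} (hm : m ≤ 2) (v : ℕ → Fin m → ℂ) (a : ℕ → ℂ)
    (ham : a m = 1) (h : ∀ j, ∑ k : Fin (m + 1), a k * v k j = 0)
    (hdet : Matrix.det (Matrix.of fun j k : Fin m => v k j) ≠ 0) (k : Fin (m + 1)) :
    (-1) ^ (m - (k : ℕ)) * (Matrix.det (Matrix.of fun j i : Fin m => v (k.succAbove i) j)
      / Matrix.det (Matrix.of fun j k : Fin m => v k j)) = a k := by
  interval_cases m
  · fin_cases k
    simp [ham]
  · have h0 := h 0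
    simp [Fin.sum_univ_succ, ham] at h0
    simp at hdet
    fin_cases k
    · simp
      field_simp
      linear_combination -h0
    · simp [ham, hdet]
  · have h0 := h 0
    have h1 := h 1
    simp [Fin.sum_univ_three, ham] at h0 h1
    rw [Matrix.det_fin_two] at hdet ⊢
    rw [Matrix.det_fin_two]
    simp at hdet
    fin_cases k
    · simp [Fin.succAbove]
      rw [div_eq_iff hdet]
      -- Eliminates `a 1` between the two rows; the case below eliminates `a 0`.
      linear_combination v 1 0 * h1 - v 1 1 * h0
    · simp [Fin.succAbove, Fin.lt_def]
      rw [← neg_div, div_eq_iff hdet]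
      linear_combination v 0 1 * h0 - v 0 0 * h1
    · simpa [Fin.succAbove, Fin.lt_def, ham] using hdet

/-- Division of a polynomial relation by a nonzero constant. -/
theorem relation_of_cleared {K x b r e0 e1 e2 a0 a1 a2 : ℂ} {A p0 p1 p2 : ℂ[X]} (hK : K ≠ 0)
    (h : C K * A = C r * (C e2 * p2 + C e1 * p1 + C e0 * p0))
    (h0 : x * r * e0 = K * b * a0) (h1 : x * r * e1 = K * b * a1) (h2 : x * r * e2 = K * b * a2) :
    C x * A = C b * (C a0 * p0 + C a1 * p1 + C a2 * p2) := by
  have hK' : (C K : ℂ[X]) ≠ 0 := by rwa [Ne, C_eq_zero]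
  refine mul_left_cancel₀ hK' ?_
  replace h0 := congrArg (C : ℂ → ℂ[X]) h0
  replace h1 := congrArg (C : ℂ → ℂ[X]) h1
  replace h2 := congrArg (C : ℂ → ℂ[X]) h2
  simp only [C_mul] at h0 h1 h2
  linear_combination C x * h + p0 * h0 + p1 * h1 + p2 * h2

theorem relation_of_cleared_sub {K x b r e0 e1 e2 a0 a1 a2 : ℂ} {A p0 p1 p2 : ℂ[X]} (hK : K ≠ 0)
    (h : C K * A = C r * (C e2 * p2 - C e1 * p1 - C e0 * p0))
    (h0 : x * r * -e0 = K * b * a0) (h1 : x * r * -e1 = K * b * a1) (h2 : x * r * e2 = K * b * a2) :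
    C x * A = C b * (C a0 * p0 + C a1 * p1 + C a2 * p2) := by
  refine relation_of_cleared hK ?_ h0 h1 h2
  rw [h, C_neg, C_neg]
  ring

/-- The relation among `(a)_N / N!` for three consecutive `N`. -/
theorem poch_div_factorial_relation (a b : ℂ) (n : ℕ) :
    (n + 1) * (n + 2) * (2 * n + a + b) * (poch a (n + 2) / (n + 2).factorial)
      = (n + 1) * (a - b) * (2 * n + a + b + 1) * (poch a (n + 1) / (n + 1).factorial)
        + (n + a) * (n + b) * (2 * n + a + b + 2) * (poch a n / n.factorial) := by
  have hn : (n.factorial : ℂ) ≠ 0 := by exact_mod_cast n.factorial_ne_zero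
  have hn1 : (n + 1 : ℂ) ≠ 0 := by exact_mod_cast n.succ_ne_zero
  have hn2 : (n + 2 : ℂ) ≠ 0 := by exact_mod_cast (n + 1).succ_ne_zero
  simp only [poch_succ, Nat.factorial_succ]
  push_cast
  rw [show (n + 1 + 1 : ℂ) = n + 2 by ring]
  field_simp
  ring

theorem poch_ne_zero_of_pos {x : ℝ} (hx : 0 < x) (N : ℕ) : poch x N ≠ 0 := by
  rw [poch_ne_zero_iff]
  intro k _ h
  have : x + k = 0 := by exact_mod_cast h
  have : (0 : ℝ) ≤ k := k.cast_nonneg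
  linarith

/-- The remaining `(n+2+t)_n` belongs to the shifted parameter `t + 2`. It cancels in `β_n`, leaving
the two exposed factors. -/
theorem poch_add_two (t : ℂ) (n : ℕ) :
    poch (n + 2 + t) (n + 2) = poch (n + 2 + t) n * (2 * n + 2 + t) * (2 * n + 3 + t) := by
  rw [poch_succ, poch_succ]
  push_cast
  ring

/-- The recurrence of `(N + t)_N` in `N`. -/
theorem poch_diag_succ (t : ℂ) (n : ℕ) :
    (n + t) * poch (((n + 1 : ℕ) : ℂ) + t) (n + 1)
      = poch (n + t) n * (2 * n + t) * (2 * n + t + 1) := by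
  have h := poch_succ_left (n + t) (n + 1)
  rw [poch_succ, poch_succ, show (n : ℂ) + t + 1 = ((n + 1 : ℕ) : ℂ) + t by push_cast; ring] at h
  rw [← h]
  push_cast
  ring

/-! ### Determinant formulas for `α` -/

namespace OQM

theorem m_le_two (S : OQM) : S.m ≤ 2 := by cases S <;> simp [m]

theorem alpha_eq_of_sum_eq_zero {S : OQM} {n : ℕ} (hdet : S.det n S.initialIdx ≠ 0) (a : ℕ → ℂ)
    (ham : a S.m = 1) (h : ∀ j, ∑ k : Fin (S.m + 1), a k * S.value (n + k) j = 0)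
    (k : Fin (S.m + 1)) : S.alpha n k = a k :=
  cramer_of_sum_eq_zero S.m_le_two (fun k j => S.value (n + k) j) a ham h hdet k

/-- Row `j` of the normalized matrix is row `j` of the plain one divided by `P_n(η_j)`, so both
determinants acquire the same nonzero factor. It cancels even when the denominator determinant is
zero. -/
theorem alpha_eq_normalized (S : OQM) (n : ℕ) (hv : ∀ j : Fin S.m, S.value n j ≠ 0)
    (k : Fin (S.m + 1)) :
    S.alpha n k = (-1) ^ (S.m - (k : ℕ)) * (S.D n (S.removeIdx k) / S.D n S.initialIdx) := by
  have hD : ∀ l, S.D n l = (∏ j, (S.value n j)⁻¹) * S.det n l := by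
    intro l
    rw [D, det, ← Matrix.det_mul_column]
    congr 1
    ext j k
    simp [div_eq_inv_mul]
  have hprod : ∏ j, (S.value n j)⁻¹ ≠ 0 := Finset.prod_ne_zero_iff.2 fun j _ => inv_ne_zero (hv j)
  rw [alpha, hD, hD, mul_div_mul_left _ _ hprod]

/-! ### The families through the base polynomials; values at the zeros of `Φ` -/

theorem L_P (g : ℝ) (n : ℕ) : (L g).P n = laguerrePoly (g + 1 / 2) n := rfl

theorem B_P (h : ℝ) (n : ℕ) : (B h).P n = (besselPoly (-2 * h) n).comp (C (-1 / 2) * X) := by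
  rw [besselPoly, truncPoly_comp]
  simp only [P, besselCoeff]
  rw [show (n : ℂ) - 2 * h = n + -2 * h by ring]

theorem J_P (g h : ℝ) (n : ℕ) :
    (J g h).P n = (jacobiPoly (g + 1 / 2) (g + h) n).comp (C (1 / 2) * (1 - C 1 * X)) := by
  rw [jacobiPoly, truncPoly_comp]
  simp only [P, jacobiCoeff]
  rw [show (n : ℂ) + g + h = n + (g + h) by ring, C_1, one_mul]

/-- The factor between the monic pseudo Jacobi polynomial and the Jacobi polynomial. -/
def pJFactor (h : ℝ) (n : ℕ) : ℂ :=
  (-2 * Complex.I) ^ n * n.factorial / poch (n + -2 * h) n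

theorem pJ_P (h μ : ℝ) (n : ℕ) :
    (pJ h μ).P n = C (pJFactor h n) *
      (jacobiPoly (-h + 1 / 2 - Complex.I * μ) (-2 * h) n).comp
        (C (1 / 2) * (1 - C Complex.I * X)) := by
  have hn : (n.factorial : ℂ) ≠ 0 := by exact_mod_cast n.factorial_ne_zero
  rw [jacobiPoly, truncPoly_comp, Finset.mul_sum]
  simp only [P, jacobiCoeff, pJFactor]
  refine Finset.sum_congr rfl fun k _ => ?_
  rw [← mul_assoc (C _) (C _), ← C_mul, show (n : ℂ) - 2 * h = n + -2 * h by ring]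
  congr 2
  generalize poch (n + -2 * h : ℂ) n = p
  field_simp

theorem L_value (g : ℝ) (n : ℕ) (j : Fin (L g).m) :
    (L g).value n j = poch (g + 1 / 2) n / n.factorial := by
  have hj : (L g).node j = (0, 0) := by
    change Fin 1 at j
    fin_cases j
    rfl
  rw [value, hj, L_P]
  exact eval_laguerrePoly_zero _ _

theorem B_value_zero (h : ℝ) (n : ℕ) : (B h).value n (0 : Fin 2) = 1 := by
  change eval 0 ((B h).P n) = 1
  rw [B_P, eval_comp]
  simp [← coeff_zero_eq_eval_zero, coeff_besselPoly, besselCoeff, poch_zero]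

theorem B_value_one (h : ℝ) (n : ℕ) : (B h).value n (1 : Fin 2) = n * (n - 2 * h) / 2 := by
  change eval 0 (derivative ((B h).P n)) = _
  rw [B_P, derivative_comp]
  simp [eval_comp, ← coeff_zero_eq_eval_zero, coeff_derivative, coeff_besselPoly, besselCoeff,
    poch_one, -mul_eq_mul_left_iff]
  ring

theorem J_value_zero (g h : ℝ) (n : ℕ) :
    (J g h).value n (0 : Fin 2) = poch (g + 1 / 2) n / n.factorial := by
  change eval 1 ((J g h).P n) = _
  rw [J_P, eval_comp, ← eval_jacobiPoly_zero _ (g + h)]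
  simp

theorem J_value_one (g h : ℝ) (n : ℕ) :
    (J g h).value n (1 : Fin 2) = (-1) ^ n * (poch (h + 1 / 2) n / n.factorial) := by
  change eval (-1) ((J g h).P n) = _
  rw [J_P, eval_comp]
  have h1 := eval_jacobiPoly_one (g + 1 / 2) (g + h) n
  rw [show (g : ℂ) + h + 1 - (g + 1 / 2) = h + 1 / 2 by ring, mul_div_assoc] at h1
  rw [← h1]
  congr 1
  simp
  norm_num

/-- `η = i` corresponds to `y = (1-iη)/2 = 1`, the Chu–Vandermonde endpoint, while `η = -i`
corresponds to `y = 0`. -/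
theorem pJ_value_zero (h μ : ℝ) (n : ℕ) :
    (pJ h μ).value n (0 : Fin 2)
      = (2 * Complex.I) ^ n * poch (-h + 1 / 2 + Complex.I * μ) n / poch (n + -2 * h) n := by
  change eval Complex.I ((pJ h μ).P n) = _
  have hn : (n.factorial : ℂ) ≠ 0 := by exact_mod_cast n.factorial_ne_zero
  have h1 := eval_jacobiPoly_one (-h + 1 / 2 - Complex.I * μ) (-2 * h) n
  rw [show (-2 * h + 1 - (-h + 1 / 2 - Complex.I * μ) : ℂ) = -h + 1 / 2 + Complex.I * μ by
    ring] at h1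
  rw [pJ_P, eval_mul, eval_comp, eval_C,
    show eval Complex.I (C (1 / 2) * (1 - C Complex.I * X) : ℂ[X]) = 1 by simp; norm_num, h1,
    pJFactor, show (-2 * Complex.I) = (-1) * (2 * Complex.I) by ring, mul_pow (-1)]
  have h2 : ((-1 : ℂ) ^ n) * (-1) ^ n = 1 := by rw [← mul_pow]; simp
  generalize poch (n + -2 * h : ℂ) n = p
  generalize poch (-h + 1 / 2 + Complex.I * μ : ℂ) n = q
  calc _ = (2 * Complex.I) ^ n * q / p * ((-1) ^ n * (-1) ^ n) := by field_simp
    _ = _ := by rw [h2, mul_one]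

theorem pJ_value_one (h μ : ℝ) (n : ℕ) :
    (pJ h μ).value n (1 : Fin 2)
      = (-2 * Complex.I) ^ n * poch (-h + 1 / 2 - Complex.I * μ) n / poch (n + -2 * h) n := by
  change eval (-Complex.I) ((pJ h μ).P n) = _
  have hn : (n.factorial : ℂ) ≠ 0 := by exact_mod_cast n.factorial_ne_zero
  rw [pJ_P, eval_mul, eval_comp, eval_C,
    show eval (-Complex.I) (C (1 / 2) * (1 - C Complex.I * X) : ℂ[X]) = 0 by simp,
    eval_jacobiPoly_zero, pJFactor]
  field_simp

/-! ### Leading coefficients -/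

theorem He_c (n : ℕ) : He.c n = 2 ^ n := by
  have hn : (n.factorial : ℂ) ≠ 0 := by exact_mod_cast n.factorial_ne_zero
  simp only [c, P, finsetSum_coeff, coeff_C_mul, mul_pow, ← C_pow, coeff_X_pow]
  rw [Finset.sum_eq_single 0]
  · simp [hn]
  · intro k hk hk0
    have := Finset.mem_range.1 hk
    rw [if_neg (by omega)]
    simp
  · simp

theorem L_c (g : ℝ) (n : ℕ) : (L g).c n = (-1) ^ n / n.factorial := by
  rw [c, L_P, coeff_laguerrePoly, laguerreCoeff_self]

theorem B_c (h : ℝ) (n : ℕ) : (B h).c n = poch (n + -2 * h) n / 2 ^ n := by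
  rw [c, B_P, besselPoly, coeff_truncPoly_comp _ _ (by compute_degree), besselCoeff_self,
    coeff_C_mul, coeff_X_one, mul_one, mul_right_comm, ← mul_pow]
  rw [show (-1 * (-1 / 2) : ℂ) = 2⁻¹ by norm_num, inv_pow]
  ring

theorem J_c (g h : ℝ) (n : ℕ) :
    (J g h).c n = poch (n + (g + h)) n / (n.factorial * 2 ^ n) := by
  rw [c, J_P, jacobiPoly, coeff_truncPoly_comp _ _ (natDegree_half_mul _), jacobiCoeff_self,
    coeff_half_mul, mul_div_assoc, mul_right_comm, ← mul_pow]
  rw [show (-1 * (-1 / 2) : ℂ) = 2⁻¹ by norm_num, inv_pow]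
  field_simp

theorem pJ_c {h μ : ℝ} {n : ℕ} (hP : poch (n + -2 * h : ℂ) n ≠ 0) : (pJ h μ).c n = 1 := by
  have hn : (n.factorial : ℂ) ≠ 0 := by exact_mod_cast n.factorial_ne_zero
  rw [c, pJ_P, coeff_C_mul, jacobiPoly, coeff_truncPoly_comp _ _ (natDegree_half_mul _),
    jacobiCoeff_self, coeff_half_mul, pJFactor]
  -- The normalization, the sign in `(-n)_n` and the slope `-i/2` of the substitution multiply to
  -- `(-2i)(-1)(-i/2) = 1`.
  have h2 : (-2 * Complex.I) ^ n * (-1) ^ n * (-Complex.I / 2) ^ n = 1 := by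
    rw [← mul_pow, ← mul_pow, show -2 * Complex.I * -1 * (-Complex.I / 2)
      = -(Complex.I * Complex.I) by ring, Complex.I_mul_I]
    simp
  calc _ = (-2 * Complex.I) ^ n * (-1) ^ n * (-Complex.I / 2) ^ n := by
        generalize poch (n + -2 * h : ℂ) n = p at *
        field_simp
    _ = 1 := h2

theorem Phi_eq_C_mul_prod {S : OQM} {a : ℂ} {p : ℂ[X]} (h : S.Phi = C a * p) (hp : p.Monic) :
    S.cPhi = a := by
  rw [cPhi, h, leadingCoeff_mul, hp.leadingCoeff, leadingCoeff_C, mul_one]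

theorem cPhi_He : He.cPhi = 1 :=
  Phi_eq_C_mul_prod (p := 1) (by simp [Phi, c2, cF, ← C_mul]) monic_one

theorem cPhi_L (g : ℝ) : (L g).cPhi = 1 :=
  Phi_eq_C_mul_prod (p := X) (by norm_num [Phi, c2, cF]) monic_X

theorem cPhi_J (g h : ℝ) : (J g h).cPhi = -(1 / 4) :=
  Phi_eq_C_mul_prod (p := X ^ 2 - C 1) (by norm_num [Phi, c2, cF, C_neg]; ring)
    (monic_X_pow_sub_C _ two_ne_zero)

theorem cPhi_B (h : ℝ) : (B h).cPhi = 1 :=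
  Phi_eq_C_mul_prod (p := X ^ 2) (by rw [Phi, c2, cF, ← mul_assoc, ← C_mul]; norm_num)
    (monic_X_pow 2)

theorem cPhi_pJ (h μ : ℝ) : (pJ h μ).cPhi = 1 :=
  Phi_eq_C_mul_prod (p := X ^ 2 + C 1)
    (by rw [Phi, c2, cF, ← mul_assoc, ← C_mul]; norm_num [add_comm])
    (monic_X_pow_add_C _ two_ne_zero)

/-! ### Reduced coefficients and nonvanishing factors -/

/-- The coefficients `α_{n,k}` in a form that needs, for pseudo Jacobi, only that
`P_n`, `P_{n+1}`, `P_{n+2}` are defined. -/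
def alphaReduced : OQM → ℕ → ℕ → ℂ
  | pJ h μ, n, 0 => ((2 * n + 1 - 2 * h) ^ 2 + 4 * μ ^ 2) * (n + 1 - 2 * h) * poch (n + -2 * h) n
      / (poch ((n + 1 : ℕ) + -2 * h) (n + 1) * (2 * n + 1 - 2 * h) * (2 * n + 2 - 2 * h))
  | S, n, k => S.alphaExplicit n k

/-- The conditions under which the differential relation holds with the coefficients
`alphaReduced`. -/
def RelationRegular : OQM → ℕ → Prop
  | pJ h μ, n => ∀ k ≤ 2, (pJ h μ).PDefined (n + k)
  | S, n => S.ExplicitRegular n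

theorem pJ_PDefined_iff (h μ : ℝ) (n : ℕ) :
    (pJ h μ).PDefined n ↔ poch (n + -2 * h) n ≠ 0 := by
  rw [PDefined, show (n : ℂ) - 2 * h = n + -2 * h by ring]

theorem poch_add_two_factors {t : ℂ} {n : ℕ} (h : poch (((n + 2 : ℕ) : ℂ) + t) (n + 2) ≠ 0) :
    2 * n + 2 + t ≠ 0 ∧ 2 * n + 3 + t ≠ 0 ∧ poch (n + 2 + t) n ≠ 0 := by
  push_cast at h
  rw [poch_add_two, mul_ne_zero_iff, mul_ne_zero_iff] at h
  tauto

/-- The first and last factors of `(n+1-2h)_{n+1}` and the last two of `(n+2-2h)_{n+2}` are exactly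
the linear denominators that occur. -/
theorem pJ_factors {h μ : ℝ} {n : ℕ} (hr : (pJ h μ).RelationRegular n) :
    poch (n + -2 * h) n ≠ 0 ∧ poch ((n + 1 : ℕ) + -2 * h) (n + 1) ≠ 0 ∧
      poch ((n + 2 : ℕ) + -2 * h) (n + 2) ≠ 0 ∧ (n : ℂ) + 1 - 2 * h ≠ 0 ∧
      (2 * n + 1 - 2 * h : ℂ) ≠ 0 ∧ (2 * n + 2 - 2 * h : ℂ) ≠ 0 ∧ (2 * n + 3 - 2 * h : ℂ) ≠ 0 ∧
      poch (n + 2 + -2 * h) n ≠ 0 := by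
  have p0 := (pJ_PDefined_iff h μ n).1 (hr 0 (by norm_num))
  have p1 := (pJ_PDefined_iff h μ (n + 1)).1 (hr 1 (by norm_num))
  have p2 := (pJ_PDefined_iff h μ (n + 2)).1 (hr 2 (by norm_num))
  have h1 := (poch_ne_zero_iff _ _).1 p1 0 (by omega)
  have h2 := (poch_ne_zero_iff _ _).1 p1 n (by omega)
  have h3 := poch_add_two_factors p2
  refine ⟨p0, p1, p2, ?_, ?_, ?_, ?_, h3.2.2⟩
  · convert h1 using 1; push_cast; ring
  · convert h2 using 1; push_cast; ring
  · convert h3.1 using 1; ring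
  · convert h3.2.1 using 1; ring

theorem pJ_succ (h : ℝ) (n : ℕ) :
    (n + 1 - 2 * h) * poch ((n + 2 : ℕ) + -2 * h) (n + 2)
      = poch ((n + 1 : ℕ) + -2 * h) (n + 1) * (2 * n + 2 - 2 * h) * (2 * n + 3 - 2 * h) := by
  have := poch_diag_succ (-2 * h) (n + 1)
  push_cast at this ⊢
  rw [show (n + 1 + 1 : ℂ) = n + 2 by ring] at this
  linear_combination this

/-! ### Differential relations for the five families -/

theorem He_derivative (n : ℕ) : derivative (He.P (n + 1)) = C (2 * (n + 1) : ℂ) * He.P n := by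
  have hd : ∀ j : ℕ, derivative ((C 2 * X : ℂ[X]) ^ j)
      = C (2 * j : ℂ) * (C 2 * X) ^ (j - 1) := by
    intro j
    rw [derivative_pow, derivative_C_mul_X, C_mul]
    simp only [C_eq_natCast]
    ring
  simp only [P, derivative_sum, derivative_C_mul, hd, Finset.mul_sum]
  have hsub : Finset.range (n / 2 + 1) ⊆ Finset.range ((n + 1) / 2 + 1) := by
    rw [Finset.range_subset_range]; omega
  -- For odd `n` the sum for `n + 1` has one more term; it is constant and its derivative is zero.
  rw [← Finset.sum_subset hsub]
  · refine Finset.sum_congr rfl fun k hk => ?_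
    have hk' : 2 * k ≤ n := by have := Finset.mem_range.1 hk; omega
    rw [show n + 1 - 2 * k = n - 2 * k + 1 by omega, Nat.factorial_succ, Nat.factorial_succ,
      Nat.add_sub_cancel, ← mul_assoc, ← mul_assoc, ← C_mul, ← C_mul]
    congr 2
    have h1 : ((n - 2 * k + 1 : ℕ) : ℂ) ≠ 0 := by exact_mod_cast (n - 2 * k).succ_ne_zero
    have h2 : ((n - 2 * k).factorial : ℂ) ≠ 0 := by exact_mod_cast (n - 2 * k).factorial_ne_zero
    have h3 : (k.factorial : ℂ) ≠ 0 := by exact_mod_cast k.factorial_ne_zero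
    rw [Nat.cast_mul ((n - 2 * k) + 1), Nat.cast_mul (n + 1), Nat.cast_succ n]
    field_simp
  · intro k hk hk'
    simp only [Finset.mem_range, not_lt] at hk hk'
    rw [show n + 1 - 2 * k = 0 by omega]
    simp

theorem J_explicitRegular_complex {g h : ℝ} {n : ℕ} (hr : (J g h).ExplicitRegular n) :
    (2 * n + (g + h) + 1 : ℂ) ≠ 0 ∧ (2 * n + (g + h) + 2 : ℂ) ≠ 0 ∧
      (2 * n + (g + h) + 3 : ℂ) ≠ 0 := by
  simp only [ExplicitRegular, add_assoc] at hr ⊢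
  exact_mod_cast hr

theorem B_explicitRegular_complex {h : ℝ} {n : ℕ} (hr : (B h).ExplicitRegular n) :
    (2 * n - 2 * h + 1 : ℂ) ≠ 0 ∧ (2 * n - 2 * h + 2 : ℂ) ≠ 0 ∧ (2 * n - 2 * h + 3 : ℂ) ≠ 0 := by
  simp only [ExplicitRegular] at hr
  exact_mod_cast hr

theorem L_relation (g : ℝ) (n : ℕ) :
    C (4 / (L g).cF) * (L g).c2 * derivative ((L g).P (n + 1))
      = C ((L g).betaFExplicit n) *
        (C ((L g).alphaReduced n 0) * (L g).P n + C ((L g).alphaReduced n 1) * (L g).P (n + 1)) := by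
  have hn1 : (n + 1 : ℂ) ≠ 0 := by exact_mod_cast n.succ_ne_zero
  have h := laguerrePoly_relation (g + 1 / 2) n
  have h2 : (C (4 / 2) : ℂ[X]) * C (n + (g + 1 / 2) : ℂ)
      = -(C (2 * (n + 1) : ℂ) * C (-((n + g + 1 / 2) / (n + 1) : ℂ))) := by
    rw [← C_mul, ← C_mul, ← C_neg]
    congr 1
    field_simp
    ring
  have h3 : (C (4 / 2) : ℂ[X]) * C (n + 1 : ℂ) = C (2 * (n + 1) : ℂ) := by
    rw [← C_mul]; norm_num
  simp only [L_P, cF, c2, betaFExplicit, alphaReduced, alphaExplicit, C_1]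
  rw [mul_assoc, h]
  linear_combination h3 * laguerrePoly (g + 1 / 2 : ℂ) (n + 1)
    - h2 * laguerrePoly (g + 1 / 2 : ℂ) n

theorem J_relation {g h : ℝ} {n : ℕ} (hr : (J g h).ExplicitRegular n) :
    C (4 / (J g h).cF) * (J g h).c2 * derivative ((J g h).P (n + 1))
      = C ((J g h).betaFExplicit n) *
        (C ((J g h).alphaReduced n 0) * (J g h).P n + C ((J g h).alphaReduced n 1) * (J g h).P (n + 1)
          + C ((J g h).alphaReduced n 2) * (J g h).P (n + 2)) := by
  obtain ⟨r1, r2, r3⟩ := J_explicitRegular_complex hr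
  have hn1 : (n + 1 : ℂ) ≠ 0 := by exact_mod_cast n.succ_ne_zero
  have hn2 : (n + 2 : ℂ) ≠ 0 := by exact_mod_cast (n + 1).succ_ne_zero
  have hrel := jacobiPoly_comp_relation (g + 1 / 2) (g + h) 1 n
  simp only [← J_P] at hrel
  rw [C_1, one_mul] at hrel
  rw [mul_assoc]
  have e1 : (n + 1 + 1 : ℂ) = n + 2 := by ring
  have e2 : (2 * n + g + h + 2 + 1 : ℂ) = 2 * n + g + h + 3 := by ring
  refine relation_of_cleared_sub (mul_ne_zero (mul_ne_zero r1 r2) r3) hrel ?_ ?_ ?_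
  all_goals
    simp only [cF, betaFExplicit, alphaReduced, alphaExplicit, poch_two, ← add_assoc, e1, e2]
      at r1 r2 r3 ⊢
    field_simp
  all_goals ring

theorem B_relation {h : ℝ} {n : ℕ} (hr : (B h).ExplicitRegular n) :
    C (4 / (B h).cF) * (B h).c2 * derivative ((B h).P (n + 1))
      = C ((B h).betaFExplicit n) *
        (C ((B h).alphaReduced n 0) * (B h).P n + C ((B h).alphaReduced n 1) * (B h).P (n + 1)
          + C ((B h).alphaReduced n 2) * (B h).P (n + 2)) := by
  obtain ⟨r1, r2, r3⟩ := B_explicitRegular_complex hr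
  have hrel := congrArg (fun p => p.comp (C (-1 / 2) * X)) (besselPoly_relation (-2 * h) n)
  simp only [mul_comp, sub_comp, add_comp, C_comp, pow_comp, X_comp, ← B_P] at hrel
  have hd : derivative ((B h).P (n + 1))
      = C (-1 / 2) * (derivative (besselPoly (-2 * h) (n + 1))).comp (C (-1 / 2) * X) := by
    rw [B_P, derivative_comp, derivative_C_mul_X]
  -- With `y = -η/2`, `y² = η²/4 = c_2` and `d/dy = -2 d/dη`.
  have hA : (C (-1 / 2) * X) ^ 2 * (derivative (besselPoly (-2 * h) (n + 1))).comp (C (-1 / 2) * X)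
      = C (-2) * ((B h).c2 * derivative ((B h).P (n + 1))) := by
    have e : (C (-1 / 2) : ℂ[X]) ^ 2 = C (-2) * C (1 / 4) * C (-1 / 2) := by
      rw [← C_pow, ← C_mul, ← C_mul]; norm_num
    rw [hd, c2]
    linear_combination (X ^ 2
      * (derivative (besselPoly (-2 * h) (n + 1))).comp (C (-1 / 2) * X)) * e
  rw [hA, ← mul_assoc, ← C_mul, sub_eq_add_neg, ← neg_mul (C _ : ℂ[X]), ← C_neg] at hrel
  rw [mul_assoc]
  have r2' : (n - h + 1 : ℂ) ≠ 0 := fun h0 => r2 (by linear_combination 2 * h0)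
  refine relation_of_cleared ?_ hrel ?_ ?_ ?_
  · convert mul_ne_zero two_ne_zero (mul_ne_zero (mul_ne_zero r1 r2) r3) using 1
    ring
  all_goals
    simp only [cF, betaFExplicit, alphaReduced, alphaExplicit, poch_two]
    rw [show (2 * n - 2 * h + 2 + 1 : ℂ) = 2 * n - 2 * h + 3 by ring,
      show (2 * n + -2 * h : ℂ) = 2 * n - 2 * h by ring]
    simp only [← mul_sub] at r1 r3 ⊢
    field_simp
    ring

theorem pJ_relation {h μ : ℝ} {n : ℕ} (hr : (pJ h μ).RelationRegular n) :
    C (4 / (pJ h μ).cF) * (pJ h μ).c2 * derivative ((pJ h μ).P (n + 1))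
      = C ((pJ h μ).betaFExplicit n) *
        (C ((pJ h μ).alphaReduced n 0) * (pJ h μ).P n
          + C ((pJ h μ).alphaReduced n 1) * (pJ h μ).P (n + 1)
          + C ((pJ h μ).alphaReduced n 2) * (pJ h μ).P (n + 2)) := by
  obtain ⟨p0, p1, p2, r0, r1, r2, r3, -⟩ := pJ_factors hr
  have hs := pJ_succ h n
  have hf : ∀ N : ℕ, (N.factorial : ℂ) ≠ 0 := fun N => by exact_mod_cast N.factorial_ne_zero
  have hn1 : (n + 1 : ℂ) ≠ 0 := by exact_mod_cast n.succ_ne_zero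
  have hn2 : (n + 2 : ℂ) ≠ 0 := by exact_mod_cast (n + 1).succ_ne_zero
  have hI : (-2 * Complex.I) ≠ 0 := by simp
  have hk : ∀ {N : ℕ}, poch (N + -2 * h) N ≠ 0 → pJFactor h N ≠ 0 := fun {N} hp =>
    div_ne_zero (mul_ne_zero (pow_ne_zero _ hI) (hf N)) hp
  have k0 := hk p0
  have k1 := hk p1
  have k2 := hk p2
  -- The Jacobi polynomials are expressed back through the monic ones, so that the Jacobi relation
  -- becomes one among the `P_N`.
  have hQ : ∀ {N : ℕ}, pJFactor h N ≠ 0 →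
      (jacobiPoly (-h + 1 / 2 - Complex.I * μ) (-2 * h) N).comp
        (C (1 / 2) * (1 - C Complex.I * X)) = C (pJFactor h N)⁻¹ * (pJ h μ).P N := by
    intro N hN
    rw [pJ_P, ← mul_assoc, ← C_mul, inv_mul_cancel₀ hN, C_1, one_mul]
  have hrel := jacobiPoly_comp_relation (-h + 1 / 2 - Complex.I * μ) (-2 * h) Complex.I n
  have hA : (1 - (C Complex.I * X) ^ 2 : ℂ[X]) = C 4 * (pJ h μ).c2 := by
    have e1 : (C 4 * C (1 / 4) : ℂ[X]) = 1 := by rw [← C_mul]; norm_num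
    have e2 : (C Complex.I : ℂ[X]) * C Complex.I = -1 := by rw [← C_mul]; simp
    rw [c2]
    linear_combination -(1 + X ^ 2) * e1 - X ^ 2 * e2
  rw [hQ k0, hQ k1, hQ k2, derivative_C_mul, hA,
    show C 4 * (pJ h μ).c2 * (C (pJFactor h (n + 1))⁻¹ * derivative ((pJ h μ).P (n + 1)))
      = C (4 * (pJFactor h (n + 1))⁻¹) * ((pJ h μ).c2 * derivative ((pJ h μ).P (n + 1))) by
        rw [C_mul]; ring] at hrel
  simp only [← mul_assoc] at hrel
  rw [mul_assoc (C _ * C _)] at hrel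
  simp only [← C_mul] at hrel
  rw [mul_assoc]
  have hI2 : Complex.I ^ 2 = -1 := Complex.I_sq
  refine relation_of_cleared_sub ?_ hrel ?_ ?_ ?_
  · refine mul_ne_zero ?_ (mul_ne_zero (by norm_num) (inv_ne_zero k1))
    convert mul_ne_zero (mul_ne_zero r1 r2) r3 using 1
    ring
  all_goals
    have e1 : (2 * n + -2 * h + 1 : ℂ) = 2 * n + 1 - 2 * h := by ring
    have e2 : (2 * n + -2 * h + 2 : ℂ) = 2 * n + 2 - 2 * h := by ring
    have e3 : (2 * n + -2 * h + 3 : ℂ) = 2 * n + 3 - 2 * h := by ring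
    have e4 : (n + -2 * h + 1 : ℂ) = n + 1 - 2 * h := by ring
    have e6 : (2 * h - 2 * n - 1 : ℂ) = -(2 * n + 1 - 2 * h) := by ring
    have e7 : (2 * h - 2 * n - 3 : ℂ) = -(2 * n + 3 - 2 * h) := by ring
    have e8 : (2 * h - n - 1 : ℂ) = -(n + 1 - 2 * h) := by ring
    have hfn := hf n
    have r2' : (n + 1 - h : ℂ) ≠ 0 := fun h0 => r2 (by linear_combination 2 * h0)
    simp only [cF, betaFExplicit, alphaReduced, alphaExplicit, pJFactor, Nat.factorial_succ,
      e1, e2, e3, e4, e6, e7, e8, Nat.cast_mul, pow_succ]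
    generalize poch (n + -2 * h : ℂ) n = q0 at *
    generalize poch ((n + 1 : ℕ) + -2 * h : ℂ) (n + 1) = q1 at *
    generalize poch ((n + 2 : ℕ) + -2 * h : ℂ) (n + 2) = q2 at *
    have hJ : (-2 * Complex.I) ^ n ≠ 0 := pow_ne_zero _ hI
    generalize (-2 * Complex.I) ^ n = J at *
    push_cast
    try rw [show (n + 1 + 1 : ℂ) = n + 2 by ring]
    have hI0 := Complex.I_ne_zero
    generalize Complex.I = I at *
    clear hrel hQ hk hf k0 k1 k2 hr hA
    field_simp
  -- The coefficients of `P_n` and `P_{n+1}` match modulo `I² = -1`; for `P_n`, `(n+a)(n+t+1-a) =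
  -- (n-h+1/2)² + μ²`. The coefficient of `P_{n+2}` needs the recurrence `hs` of the normalizing
  -- symbols.
  · linear_combination ((2 * n + 1 - 2 * h) ^ 2 - 4 * μ ^ 2 * (I ^ 2 - 1)) * hI2
  · linear_combination 4 * μ * hI2
  · linear_combination -hs

theorem relation_reduced {S : OQM} {n : ℕ} (hr : S.RelationRegular n) :
    C (4 / S.cF) * S.c2 * derivative (S.P (n + 1))
      = C (S.betaFExplicit n) * ∑ k : Fin (S.m + 1), C (S.alphaReduced n k) * S.P (n + (k : ℕ)) := by
  cases S with
  | He =>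
    refine Eq.trans ?_ (congrArg _ (Fin.sum_univ_one fun k : Fin 1 =>
      C (He.alphaReduced n k) * He.P (n + (k : ℕ))).symm)
    have h4 : (C (4 / 1) * C (1 / 4) : ℂ[X]) = 1 := by rw [← C_mul]; norm_num
    simp only [He_derivative, cF, c2, h4, one_mul]
    simp [alphaReduced, alphaExplicit, betaFExplicit]
  | L g =>
    exact (L_relation g n).trans (congrArg _ (Fin.sum_univ_two fun k : Fin 2 =>
      C ((L g).alphaReduced n k) * (L g).P (n + (k : ℕ))).symm)
  | J g h =>
    exact (J_relation hr).trans (congrArg _ (Fin.sum_univ_three fun k : Fin 3 =>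
      C ((J g h).alphaReduced n k) * (J g h).P (n + (k : ℕ))).symm)
  | B h =>
    exact (B_relation hr).trans (congrArg _ (Fin.sum_univ_three fun k : Fin 3 =>
      C ((B h).alphaReduced n k) * (B h).P (n + (k : ℕ))).symm)
  | pJ h μ =>
    exact (pJ_relation hr).trans (congrArg _ (Fin.sum_univ_three fun k : Fin 3 =>
      C ((pJ h μ).alphaReduced n k) * (pJ h μ).P (n + (k : ℕ))).symm)

/-! ### Determinants, and the comparison of the regularity conditions -/

theorem L_det (g : ℝ) (n : ℕ) :
    (L g).det n (L g).initialIdx = poch (g + 1 / 2) n / n.factorial :=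
  (Matrix.det_fin_one (Matrix.of fun j k : Fin 1 =>
    (L g).value (n + (L g).initialIdx k) j)).trans (L_value g n _)

/-- The point is the factor `2n+g+h+1`, the explicit denominator that `c_{n+2}` does not control. -/
theorem J_det (g h : ℝ) (n : ℕ) :
    (J g h).det n (J g h).initialIdx = (-1) ^ (n + 1) * (poch (g + 1 / 2) n / n.factorial)
      * (poch (h + 1 / 2) n / n.factorial) * (2 * n + (g + h) + 1) / (n + 1) := by
  refine (Matrix.det_fin_two (Matrix.of fun j k : Fin 2 =>
    (J g h).value (n + (J g h).initialIdx k) j)).trans ?_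
  change (J g h).value n (0 : Fin 2) * (J g h).value (n + 1) (1 : Fin 2)
    - (J g h).value (n + 1) (0 : Fin 2) * (J g h).value n (1 : Fin 2) = _
  have hn : (n.factorial : ℂ) ≠ 0 := by exact_mod_cast n.factorial_ne_zero
  have hn1 : (n + 1 : ℂ) ≠ 0 := by exact_mod_cast n.succ_ne_zero
  simp only [J_value_zero, J_value_one, poch_succ, Nat.factorial_succ]
  push_cast
  generalize poch (g + 1 / 2 : ℂ) n = p
  generalize poch (h + 1 / 2 : ℂ) n = q
  field_simp
  ring

theorem B_det (h : ℝ) (n : ℕ) :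
    (B h).det n (B h).initialIdx = (2 * n - 2 * h + 1) / 2 := by
  refine (Matrix.det_fin_two (Matrix.of fun j k : Fin 2 =>
    (B h).value (n + (B h).initialIdx k) j)).trans ?_
  change (B h).value n (0 : Fin 2) * (B h).value (n + 1) (1 : Fin 2)
    - (B h).value (n + 1) (0 : Fin 2) * (B h).value n (1 : Fin 2) = _
  simp only [B_value_zero, B_value_one]
  push_cast
  ring

theorem pJ_det {h μ : ℝ} {n : ℕ} (p0 : poch (n + -2 * h) n ≠ 0)
    (p1 : poch ((n + 1 : ℕ) + -2 * h) (n + 1) ≠ 0) :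
    (pJ h μ).det n (pJ h μ).initialIdx
      = (2 * Complex.I) ^ n * (-2 * Complex.I) ^ (n + 1) * poch (-h + 1 / 2 + Complex.I * μ) n
        * poch (-h + 1 / 2 - Complex.I * μ) n * (2 * n + 1 - 2 * h)
        / (poch (n + -2 * h) n * poch ((n + 1 : ℕ) + -2 * h) (n + 1)) := by
  refine (Matrix.det_fin_two (Matrix.of fun j k : Fin 2 =>
    (pJ h μ).value (n + (pJ h μ).initialIdx k) j)).trans ?_
  change (pJ h μ).value n (0 : Fin 2) * (pJ h μ).value (n + 1) (1 : Fin 2)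
    - (pJ h μ).value (n + 1) (0 : Fin 2) * (pJ h μ).value n (1 : Fin 2) = _
  simp only [pJ_value_zero, pJ_value_one, poch_succ (-h + 1 / 2 + Complex.I * μ : ℂ),
    poch_succ (-h + 1 / 2 - Complex.I * μ : ℂ), pow_succ]
  generalize poch (n + -2 * h : ℂ) n = q0 at *
  generalize poch ((n + 1 : ℕ) + -2 * h : ℂ) (n + 1) = q1 at *
  generalize poch (-h + 1 / 2 + Complex.I * μ : ℂ) n = a
  generalize poch (-h + 1 / 2 - Complex.I * μ : ℂ) n = b
  generalize (-2 * Complex.I) ^ n = u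
  generalize (2 * Complex.I) ^ n = v
  field_simp
  ring

theorem c_add_two_factors {t d : ℂ} {n : ℕ} (h : poch ((n + 2 : ℕ) + t) (n + 2) / d ≠ 0) :
    2 * n + 2 + t ≠ 0 ∧ 2 * n + 3 + t ≠ 0 ∧ poch (n + 2 + t) n ≠ 0 :=
  poch_add_two_factors fun h0 => h (by rw [h0, zero_div])

/-- For Jacobi and Bessel, the determinant contains the first explicit denominator and `c_{n+2}` the
other two. For pseudo Jacobi, definedness of the three polynomials suffices. -/
theorem Regular.relationRegular {S : OQM} {n : ℕ} (hr : S.Regular n) : S.RelationRegular n := by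
  obtain ⟨hP, hdet, hc⟩ := hr
  cases S with
  | He => trivial
  | L g => trivial
  | J g h =>
    rw [J_det] at hdet
    have h1 : (2 * n + (g + h) + 1 : ℂ) ≠ 0 := fun h0 => hdet (by rw [h0]; ring)
    change (J g h).c (n + 2) ≠ 0 at hc
    rw [J_c] at hc
    obtain ⟨h2, h3, -⟩ := c_add_two_factors hc
    refine ⟨fun h0 => h1 ?_, fun h0 => h2 ?_, fun h0 => h3 ?_⟩ <;>
    · have := congrArg (Complex.ofReal) h0
      push_cast at this
      linear_combination this
  | B h =>
    rw [B_det] at hdet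
    have h1 : (2 * n - 2 * h + 1 : ℂ) ≠ 0 := fun h0 => hdet (by rw [h0]; ring)
    change (B h).c (n + 2) ≠ 0 at hc
    rw [B_c] at hc
    obtain ⟨h2, h3, -⟩ := c_add_two_factors hc
    refine ⟨fun h0 => h1 ?_, fun h0 => h2 ?_, fun h0 => h3 ?_⟩ <;>
    · have := congrArg (Complex.ofReal) h0
      push_cast at this
      linear_combination this
  | pJ h μ => exact hP

theorem ExplicitRegular.relationRegular {S : OQM} {n : ℕ} (hr : S.ExplicitRegular n) :
    S.RelationRegular n := by
  cases S with
  | pJ h μ => exact hr.1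
  | _ => exact hr

/-- Only `α_{n,0}` of pseudo Jacobi differs in form: `poch_diag_succ` trades the ratio of Pochhammer
symbols for `(n-2h)/(2n-2h)`. The extra condition `h ≠ n` matters only at `n = h = 0`, since for `n
≥ 1` the factor `2n-2h` already occurs in `(n+1-2h)_{n+1}`. -/
theorem alphaReduced_eq {S : OQM} {n : ℕ} (hr : S.ExplicitRegular n) (k : ℕ) :
    S.alphaReduced n k = S.alphaExplicit n k := by
  cases S with
  | pJ h μ =>
    rcases k with _ | k
    · obtain ⟨p0, p1, -, -, r1, r2, -, -⟩ := pJ_factors (h := h) (μ := μ) hr.1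
      have r0 : (n - h : ℂ) ≠ 0 := by
        have := hr.2.1
        contrapose! this
        have h0 : (n : ℝ) - h = 0 := by exact_mod_cast this
        linarith
      have r2' : (n + 1 - h : ℂ) ≠ 0 := fun h0 => r2 (by linear_combination 2 * h0)
      have hs := poch_diag_succ (-2 * h) n
      simp only [alphaReduced, alphaExplicit, poch_two]
      generalize poch (n + -2 * h : ℂ) n = q0 at *
      generalize poch ((n + 1 : ℕ) + -2 * h : ℂ) (n + 1) = q1 at *
      rw [show (2 * h - 2 * n - 1 : ℂ) = -(2 * n + 1 - 2 * h) by ring,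
        show (h - n - 1 : ℂ) = -(n + 1 - h) by ring, show (-(n + 1 - h) + 1 : ℂ) = -(n - h) by ring,
        show (2 * h - n - 1 : ℂ) = -(n + 1 - 2 * h) by ring,
        show (-(n + 1 - 2 * h) + 1 : ℂ) = -(n - 2 * h) by ring]
      field_simp
      linear_combination (-2 * ((2 * n + 1 - 2 * h) ^ 2 + 4 * μ ^ 2) * (n + 1 - 2 * h)) * hs
    · rcases k with _ | k <;> rfl
  | _ => rfl

/-! ### Linear dependence at the zeros of `Φ`; identification of `α` and `β` -/

/-- Evaluating the differential relation would only give `β^F_n` times this sum, and `β^F_n`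
vanishes for instance when `n+g+h+1 = 0` (Jacobi) or `n+1 = 2h` (Bessel). Hence the verification on
closed forms. -/
theorem sum_alphaReduced_mul_value {S : OQM} {n : ℕ} (hr : S.RelationRegular n) (j : Fin S.m) :
    ∑ k : Fin (S.m + 1), S.alphaReduced n k * S.value (n + k) j = 0 := by
  have hn : (n.factorial : ℂ) ≠ 0 := by exact_mod_cast n.factorial_ne_zero
  have hn1 : (n + 1 : ℂ) ≠ 0 := by exact_mod_cast n.succ_ne_zero
  have hn2 : (n + 2 : ℂ) ≠ 0 := by exact_mod_cast (n + 1).succ_ne_zero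
  cases S with
  | He => exact Fin.elim0 j
  | L g =>
    refine (Fin.sum_univ_two fun k : Fin 2 =>
      (L g).alphaReduced n k * (L g).value (n + k) j).trans ?_
    change (L g).alphaReduced n 0 * (L g).value n j
      + (L g).alphaReduced n 1 * (L g).value (n + 1) j = 0
    simp only [L_value, alphaReduced, alphaExplicit, poch_succ, Nat.factorial_succ]
    push_cast
    field_simp
    ring
  | J g h =>
    refine (Fin.sum_univ_three fun k : Fin 3 =>
      (J g h).alphaReduced n k * (J g h).value (n + k) j).trans ?_
    obtain ⟨r1, -, -⟩ := J_explicitRegular_complex hr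
    have key : ∀ v0 v1 v2 : ℂ, (n + 1) * (n + 2) * (2 * n + (g + h) + 1) * v2
        = (n + 1) * (g - h) * (2 * n + (g + h) + 2) * v1
          + (n + (g + 1 / 2)) * (n + (h + 1 / 2)) * (2 * n + (g + h) + 3) * v0 →
        (J g h).alphaReduced n 0 * v0 + (J g h).alphaReduced n 1 * v1
          + (J g h).alphaReduced n 2 * v2 = 0 := by
      intro v0 v1 v2 hv
      simp only [alphaReduced, alphaExplicit, poch_two, ← add_assoc] at r1 ⊢
      rw [show (n + 1 + 1 : ℂ) = n + 2 by ring]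
      generalize hD : (2 * n + g + h + 1 : ℂ) = D at r1 ⊢
      field_simp
      subst hD
      linear_combination 4 * hv
    refine key _ _ _ ?_
    change Fin 2 at j
    fin_cases j
    · change _ * (J g h).value (n + 2) (0 : Fin 2) = _ * (J g h).value (n + 1) (0 : Fin 2)
        + _ * (J g h).value n (0 : Fin 2)
      rw [J_value_zero, J_value_zero, J_value_zero]
      linear_combination poch_div_factorial_relation (g + 1 / 2) (h + 1 / 2) n
    · change _ * (J g h).value (n + 2) (1 : Fin 2) = _ * (J g h).value (n + 1) (1 : Fin 2)
        + _ * (J g h).value n (1 : Fin 2)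
      rw [J_value_one, J_value_one, J_value_one]
      -- At `η = -1` the roles of `g` and `h` are exchanged; the alternating sign restores the sign
      -- of the middle term `g - h`.
      linear_combination (-1) ^ n * poch_div_factorial_relation (h + 1 / 2) (g + 1 / 2) n
  | B h =>
    refine (Fin.sum_univ_three fun k : Fin 3 =>
      (B h).alphaReduced n k * (B h).value (n + k) j).trans ?_
    obtain ⟨r1, -, -⟩ := B_explicitRegular_complex hr
    change Fin 2 at j
    fin_cases j
    · change (B h).alphaReduced n 0 * (B h).value n (0 : Fin 2)
        + (B h).alphaReduced n 1 * (B h).value (n + 1) (0 : Fin 2)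
        + (B h).alphaReduced n 2 * (B h).value (n + 2) (0 : Fin 2) = 0
      simp only [B_value_zero, alphaReduced, alphaExplicit, ← mul_sub] at r1 ⊢
      field_simp
      ring
    · change (B h).alphaReduced n 0 * (B h).value n (1 : Fin 2)
        + (B h).alphaReduced n 1 * (B h).value (n + 1) (1 : Fin 2)
        + (B h).alphaReduced n 2 * (B h).value (n + 2) (1 : Fin 2) = 0
      simp only [B_value_one, alphaReduced, alphaExplicit, ← mul_sub] at r1 ⊢
      push_cast
      field_simp
      ring
  | pJ h μ =>
    refine (Fin.sum_univ_three fun k : Fin 3 =>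
      (pJ h μ).alphaReduced n k * (pJ h μ).value (n + k) j).trans ?_
    obtain ⟨p0, p1, p2, r0, r1, r2, r3, -⟩ := pJ_factors hr
    have hs := pJ_succ h n
    have r2' : (n + 1 - h : ℂ) ≠ 0 := fun h0 => r2 (by linear_combination 2 * h0)
    have hI2 := Complex.I_sq
    change Fin 2 at j
    fin_cases j
    · change (pJ h μ).alphaReduced n 0 * (pJ h μ).value n (0 : Fin 2)
        + (pJ h μ).alphaReduced n 1 * (pJ h μ).value (n + 1) (0 : Fin 2)
        + (pJ h μ).alphaReduced n 2 * (pJ h μ).value (n + 2) (0 : Fin 2) = 0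
      simp only [pJ_value_zero, alphaReduced, alphaExplicit, pow_succ,
        poch_succ (-h + 1 / 2 + Complex.I * μ : ℂ)]
      rw [show (2 * h - 2 * n - 1 : ℂ) = -(2 * n + 1 - 2 * h) by ring,
        show (2 * h - 2 * n - 3 : ℂ) = -(2 * n + 3 - 2 * h) by ring,
        show (2 * h - n - 1 : ℂ) = -(n + 1 - 2 * h) by ring]
      generalize poch (n + -2 * h : ℂ) n = q0 at *
      generalize poch ((n + 1 : ℕ) + -2 * h : ℂ) (n + 1) = q1 at *
      generalize poch ((n + 2 : ℕ) + -2 * h : ℂ) (n + 2) = q2 at *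
      generalize poch (-h + 1 / 2 + Complex.I * μ : ℂ) n = a
      generalize (2 * Complex.I) ^ n = u
      generalize Complex.I = I at *
      push_cast
      -- Once the last normalizing symbol is eliminated, what remains is a polynomial identity
      -- modulo `I² = -1`.
      obtain rfl : q2 = q1 * (2 * n + 2 - 2 * h) * (2 * n + 3 - 2 * h) / (n + 1 - 2 * h) := by
        field_simp
        linear_combination hs
      field_simp
      linear_combination (n + 1 - 2 * h) * u * a * (4 * μ ^ 2 * (2 * n + 3 - 2 * h)
        + (2 * n + 1 - 2 * h) * (2 * n + 1 - 2 * h + 2 * μ * I)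
          * (2 * n + 3 - 2 * h + 2 * μ * I)) * hI2
    · change (pJ h μ).alphaReduced n 0 * (pJ h μ).value n (1 : Fin 2)
        + (pJ h μ).alphaReduced n 1 * (pJ h μ).value (n + 1) (1 : Fin 2)
        + (pJ h μ).alphaReduced n 2 * (pJ h μ).value (n + 2) (1 : Fin 2) = 0
      simp only [pJ_value_one, alphaReduced, alphaExplicit, pow_succ,
        poch_succ (-h + 1 / 2 - Complex.I * μ : ℂ)]
      rw [show (2 * h - 2 * n - 1 : ℂ) = -(2 * n + 1 - 2 * h) by ring,
        show (2 * h - 2 * n - 3 : ℂ) = -(2 * n + 3 - 2 * h) by ring,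
        show (2 * h - n - 1 : ℂ) = -(n + 1 - 2 * h) by ring]
      generalize poch (n + -2 * h : ℂ) n = q0 at *
      generalize poch ((n + 1 : ℕ) + -2 * h : ℂ) (n + 1) = q1 at *
      generalize poch ((n + 2 : ℕ) + -2 * h : ℂ) (n + 2) = q2 at *
      generalize poch (-h + 1 / 2 - Complex.I * μ : ℂ) n = a
      generalize (-2 * Complex.I) ^ n = u
      generalize Complex.I = I at *
      push_cast
      obtain rfl : q2 = q1 * (2 * n + 2 - 2 * h) * (2 * n + 3 - 2 * h) / (n + 1 - 2 * h) := by
        field_simp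
        linear_combination hs
      field_simp
      linear_combination (n + 1 - 2 * h) * u * a * (4 * μ ^ 2 * (2 * n + 3 - 2 * h)
        + (2 * n + 1 - 2 * h) * (2 * n + 1 - 2 * h - 2 * μ * I)
          * (2 * n + 3 - 2 * h - 2 * μ * I)) * hI2

theorem alphaReduced_m (S : OQM) (n : ℕ) : S.alphaReduced n S.m = 1 := by
  cases S <;> rfl

theorem Regular.alpha_eq {S : OQM} {n : ℕ} (hr : S.Regular n) (k : Fin (S.m + 1)) :
    S.alpha n k = S.alphaReduced n k :=
  alpha_eq_of_sum_eq_zero hr.2.1 _ (S.alphaReduced_m n)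
    (sum_alphaReduced_mul_value hr.relationRegular) k

/-- For Jacobi and Bessel the shift by `δ` replaces `t` (`g+h` or `-2h`) by `t+2`, so `c_n(λ+δ)`
cancels against all but two factors of the symbol in `c_{n+2}(λ)`. -/
theorem Regular.beta_eq {S : OQM} {n : ℕ} (hr : S.Regular n) : S.beta n = S.betaExplicit n := by
  have hrr := hr.relationRegular
  have hc := hr.2.2
  have hn : (n.factorial : ℂ) ≠ 0 := by exact_mod_cast n.factorial_ne_zero
  have hn1 : (n + 1 : ℂ) ≠ 0 := by exact_mod_cast n.succ_ne_zero
  have hn2 : (n + 2 : ℂ) ≠ 0 := by exact_mod_cast (n + 1).succ_ne_zero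
  cases S with
  | He =>
    change He.cPhi * (He.c n / He.c n) = 1
    rw [cPhi_He, He_c, div_self (pow_ne_zero n two_ne_zero), one_mul]
  | L g =>
    change (L g).cPhi * ((L (g + 1)).c n / (L g).c (n + 1)) = -(n + 1)
    rw [cPhi_L, L_c, L_c, Nat.factorial_succ, pow_succ]
    have h1 : ((-1 : ℂ) ^ n) ≠ 0 := by simp
    push_cast
    field_simp
  | J g h =>
    change (J g h).c (n + 2) ≠ 0 at hc
    change (J g h).cPhi * ((J (g + 1) (h + 1)).c n / (J g h).c (n + 2))
      = -(poch (n + 1) 2 / poch (2 * n + g + h + 2) 2)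
    rw [J_c] at hc
    obtain ⟨h2, h3, h4⟩ := c_add_two_factors hc
    rw [cPhi_J, J_c, J_c, poch_two, poch_two]
    push_cast
    rw [poch_add_two, show (n + (g + 1 + (h + 1)) : ℂ) = n + 2 + (g + h) by ring,
      show (2 * n + g + h + 2 + 1 : ℂ) = 2 * n + 3 + (g + h) by ring,
      show (2 * n + g + h + 2 : ℂ) = 2 * n + 2 + (g + h) by ring, Nat.factorial_succ,
      Nat.factorial_succ]
    generalize poch (n + 2 + (g + h) : ℂ) n = q at *
    push_cast
    field_simp
    ring
  | B h =>
    change (B h).c (n + 2) ≠ 0 at hc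
    change (B h).cPhi * ((B (h - 1)).c n / (B h).c (n + 2)) = 4 / poch (2 * n - 2 * h + 2) 2
    rw [B_c] at hc
    obtain ⟨h2, h3, h4⟩ := c_add_two_factors hc
    rw [cPhi_B, B_c, B_c, poch_two]
    push_cast
    rw [poch_add_two, show (n + -2 * (h - 1) : ℂ) = n + 2 + -2 * h by ring,
      show (2 * n - 2 * h + 2 + 1 : ℂ) = 2 * n + 3 + -2 * h by ring,
      show (2 * n - 2 * h + 2 : ℂ) = 2 * n + 2 + -2 * h by ring]
    generalize poch (n + 2 + -2 * h : ℂ) n = q at *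
    generalize (2 * n + 2 + -2 * h : ℂ) = u at *
    generalize (2 * n + 3 + -2 * h : ℂ) = v at *
    field_simp
    ring
  | pJ h μ =>
    change (pJ h μ).cPhi * ((pJ (h - 1) μ).c n / (pJ h μ).c (n + 2)) = 1
    obtain ⟨-, -, p2, -, -, -, -, h4⟩ := pJ_factors hrr
    rw [cPhi_pJ, pJ_c p2, pJ_c, div_one, one_mul]
    -- The shifted polynomial is monic because `(n-2(h-1))_n = (n+2-2h)_n` is part of the nonzero
    -- `(n+2-2h)_{n+2}`.
    convert h4 using 2
    push_cast
    ring

theorem f_mul_betaExplicit (S : OQM) (n : ℕ) :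
    S.f (n + 1) * S.betaExplicit n = S.betaFExplicit n := by
  cases S <;> simp only [f, betaExplicit, betaFExplicit] <;> push_cast <;> ring

theorem Regular.betaF_eq {S : OQM} {n : ℕ} (hr : S.Regular n) : S.betaF n = S.betaFExplicit n := by
  rw [betaF, hr.beta_eq, f_mul_betaExplicit]

/-! ### The physical range -/

/-- Each factor `n - 2h + k` with `k < n < h` is negative. -/
theorem poch_diag_ne_zero {h : ℝ} {n : ℕ} (hn : n < h) : poch (n + -2 * h) n ≠ 0 := by
  rw [poch_ne_zero_iff]
  intro k hk h0
  have h1 : (n : ℝ) + -2 * h + k = 0 := by exact_mod_cast h0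
  have h2 : (k : ℝ) < n := by exact_mod_cast hk
  linarith

/-- Integer shifts keep the imaginary part. This is where `μ ≠ 0` protects the pseudo Jacobi
determinant. -/
theorem poch_ne_zero_of_im {a : ℂ} (ha : a.im ≠ 0) (n : ℕ) : poch a n ≠ 0 := by
  rw [poch_ne_zero_iff]
  intro k _ h0
  have := congrArg Complex.im h0
  simp at this
  exact ha this

theorem Physical.explicitRegular {S : OQM} {n : ℕ} (hp : S.Physical (n + S.m)) :
    S.ExplicitRegular n := by
  have hn0 : (0 : ℝ) ≤ n := n.cast_nonneg
  cases S with
  | He => trivial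
  | L g => trivial
  | J g h =>
    obtain ⟨hg, hh⟩ := hp
    refine ⟨?_, ?_, ?_⟩ <;> positivity
  | B h =>
    obtain ⟨-, hN⟩ := hp
    change ((n + 2 : ℕ) : ℝ) < h at hN
    push_cast at hN
    refine ⟨?_, ?_, ?_⟩ <;> apply ne_of_lt <;> linarith
  | pJ h μ =>
    obtain ⟨-, -, hN⟩ := hp
    change ((n + 2 : ℕ) : ℝ) < h at hN
    refine ⟨fun k hk => ?_, ?_⟩
    · rw [pJ_PDefined_iff]
      refine poch_diag_ne_zero (lt_of_le_of_lt ?_ hN)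
      exact_mod_cast Nat.add_le_add_left hk n
    · push_cast at hN
      refine ⟨?_, ?_, ?_, ?_⟩ <;> apply ne_of_gt <;> linarith

theorem Physical.regular {S : OQM} {n : ℕ} (hp : S.Physical (n + S.m)) : S.Regular n := by
  have her := hp.explicitRegular
  have hf : ∀ N : ℕ, (N.factorial : ℂ) ≠ 0 := fun N => by exact_mod_cast N.factorial_ne_zero
  have hn1 : (n + 1 : ℂ) ≠ 0 := by exact_mod_cast n.succ_ne_zero
  cases S with
  | He =>
    refine ⟨fun _ _ => trivial, ?_, ?_⟩
    · change Matrix.det (Matrix.of fun j k : Fin 0 => He.value _ _) ≠ 0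
      rw [Matrix.det_isEmpty]
      exact one_ne_zero
    · rw [He_c]
      exact pow_ne_zero _ two_ne_zero
  | L g =>
    have hg : 1 / 2 < g := hp
    refine ⟨fun _ _ => trivial, ?_, ?_⟩
    · rw [L_det]
      refine div_ne_zero ?_ (hf n)
      have h1 := poch_ne_zero_of_pos (x := g + 1 / 2) (by linarith) n
      push_cast at h1
      exact h1
    · rw [L_c]
      exact div_ne_zero (by simp) (hf _)
  | J g h =>
    obtain ⟨hg, hh⟩ := hp
    refine ⟨fun _ _ => trivial, ?_, ?_⟩
    · rw [J_det]
      have h1 := poch_ne_zero_of_pos (x := g + 1 / 2) (by linarith) n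
      have h2 := poch_ne_zero_of_pos (x := h + 1 / 2) (by linarith) n
      push_cast at h1 h2
      exact div_ne_zero (mul_ne_zero (mul_ne_zero (mul_ne_zero (by simp) (div_ne_zero h1 (hf n)))
        (div_ne_zero h2 (hf n))) (J_explicitRegular_complex her).1) hn1
    · rw [J_c]
      refine div_ne_zero ?_ (mul_ne_zero (hf _) (pow_ne_zero _ two_ne_zero))
      have h1 := poch_ne_zero_of_pos (x := ((n + (J g h).m : ℕ) : ℝ) + (g + h)) (by positivity)
        (n + (J g h).m)
      exact_mod_cast h1
  | B h =>
    refine ⟨fun _ _ => trivial, ?_, ?_⟩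
    · rw [B_det]
      exact div_ne_zero (B_explicitRegular_complex her).1 two_ne_zero
    · rw [B_c]
      exact div_ne_zero (poch_diag_ne_zero hp.2) (pow_ne_zero _ two_ne_zero)
  | pJ h μ =>
    obtain ⟨p0, p1, p2, -, r1, -⟩ := pJ_factors (h := h) (μ := μ) her.1
    refine ⟨her.1, ?_, ?_⟩
    · rw [pJ_det p0 p1]
      have hμ : μ ≠ 0 := ne_of_gt hp.2.1
      refine div_ne_zero (mul_ne_zero (mul_ne_zero (mul_ne_zero (mul_ne_zero ?_ ?_) ?_) ?_) r1)
        (mul_ne_zero p0 p1)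
      · simp
      · simp
      · exact poch_ne_zero_of_im (by simpa using hμ) n
      · exact poch_ne_zero_of_im (by simpa using hμ) n
    · change (pJ h μ).c (n + 2) ≠ 0
      rw [pJ_c p2]
      exact one_ne_zero

end OQM

end

/-! ### The main theorem -/

theorem mainTheorem5 (S : OQM) (n : ℕ) :
    -- the differential relation
    (S.Regular n →
      Polynomial.C (4 / S.cF) * S.c2 * Polynomial.derivative (S.P (n + 1)) =
        Polynomial.C (S.betaF n) *
          ∑ k : Fin (S.m + 1), Polynomial.C (S.alpha n k) * S.P (n + (k : ℕ))) ∧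
    -- the coefficients through the normalized determinants, whenever these are defined
    ((∀ j : Fin S.m, S.value n j ≠ 0) → ∀ k : Fin (S.m + 1),
      S.alpha n k =
        (-1) ^ (S.m - (k : ℕ)) * (S.D n (S.removeIdx k) / S.D n S.initialIdx)) ∧
    -- the explicit coefficients
    (S.Regular n → S.ExplicitRegular n →
      (∀ k : Fin (S.m + 1), S.alpha n k = S.alphaExplicit n (k : ℕ)) ∧
        S.beta n = S.betaExplicit n ∧ S.betaF n = S.betaFExplicit n) ∧
    -- the differential relation with the explicit coefficients
    (S.ExplicitRegular n →
      Polynomial.C (4 / S.cF) * S.c2 * Polynomial.derivative (S.P (n + 1)) =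
        Polynomial.C (S.betaFExplicit n) *
          ∑ k : Fin (S.m + 1), Polynomial.C (S.alphaExplicit n (k : ℕ)) * S.P (n + (k : ℕ))) ∧
    -- the assumptions hold in the physical range
    (S.Physical (n + S.m) → S.Regular n ∧ S.ExplicitRegular n) := by
  have hexp : S.ExplicitRegular n →
      Polynomial.C (4 / S.cF) * S.c2 * Polynomial.derivative (S.P (n + 1)) =
        Polynomial.C (S.betaFExplicit n) *
          ∑ k : Fin (S.m + 1), Polynomial.C (S.alphaExplicit n (k : ℕ)) * S.P (n + (k : ℕ)) := by
    intro her
    rw [OQM.relation_reduced her.relationRegular]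
    simp only [OQM.alphaReduced_eq her]
  refine ⟨fun hr => ?_, fun hv k => S.alpha_eq_normalized n hv k, fun hr her =>
    ⟨fun k => ?_, hr.beta_eq, hr.betaF_eq⟩, hexp, fun hp => ⟨hp.regular, hp.explicitRegular⟩⟩
  -- The reduced coefficients are needed here, because `Regular` allows pseudo Jacobi with `n = h =
  -- 0`, where an explicit denominator vanishes.
  · rw [OQM.relation_reduced hr.relationRegular, hr.betaF_eq]
    simp only [hr.alpha_eq]
  · rw [hr.alpha_eq, OQM.alphaReduced_eq her]
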